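/- Let $n\ge 1$ and let $\mathbb H^n=\mathbb C^n\times\mathbb R$ be the Heisenberg group with group law $(z,t)(w,s)=(z+w,\;t+s+\tfrac12\operatorname{Im}(z\cdot\bar w))$, inverse $(z,t)^{-1}=(-z,-t)$ and Haar (Lebesgue) measure $dz\,dt$. For $k\in\mathbb N$ and $\lambda\in\mathbb R\setminus\{0\}$ put $$e_{k,\lambda}^{n-1}(z,t)=e^{i\lambda t}\,L_k^{n-1}\big(\tfrac12|\lambda||z|^2\big)\,e^{-\frac14|\lambda||z|^2},$$ where $L_k^{n-1}$ is the Laguerre polynomial of type $n-1$. Let $\Omega\subset\mathbb R^2$ be the Heisenberg fan, the union of the rays $R_k=\{(\lambda,(2k+n)|\lambda|):\lambda\in\mathbb R\}$, $k=0,1,2,\dots$, and of the limiting ray $R_\infty=\{(0,\tau):\tau\ge0\}$. For $a=(\lambda,(2k+n)|\lambda|)\in R_k$ with $\lambda\ne0$ put $e_a=e_{k,\lambda}^{n-1}$, and for $a=(0,\tau)\in R_\infty$ put $e_a(z,t)=(n-1)!\,2^{n-1}\,\dfrac{J_{n-1}(\sqrt\tau|z|)}{(\sqrt\tau|z|)^{n-1}}$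 (with value $1$ where $\sqrt\tau|z|=0$), where $J_{n-1}$ is the Bessel function of order $n-1$. For $f\in L^1(\mathbb H^n)$ the Strichartz Fourier transform of $f$ is $$\widehat f(a,z)=\int_{\mathbb H^n}f(w,s)\,e_a\big((w,s)^{-1}(z,0)\big)\,dw\,ds,\qquad a\in\Omega,\ z\in\mathbb C^n.$$ Let $\nu$ be the measure on $\Omega$ given by $$\int_\Omega\varphi\,d\nu=(2\pi)^{-2n-1}\int_{-\infty}^{\infty}\Big(\sum_{k=0}^\infty\varphi\big(\lambda,(2k+n)|\lambda|\big)\Big)|\lambda|^{2n}\,d\lambda .$$ **Theorem.** (i) For every Schwartz function $f$ on $\mathbb H^n$ and every $(z,t)\in\mathbb H^n$, $$f(z,t)=\int_\Omega\int_{\mathbb C^n}\widehat f(a,w)\,e_a\big((-w,0)(z,t)\big)\,dw\,d\nu(a),$$ where the inner integral converges absolutely for $\nu$-almost every $a$, and the outer integral converges absolutely. (ii) For every $f\in L^1(\mathbb H^n)\cap L^2(\mathbb H^n)$, the function $|\widehat f(a,\cdot)|^2$ is integrable on $\mathbb C^n$ for $\nu$-almost every $a$, its integral is a $\nu$-integrable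 function of $a$, and $$\int_{\mathbb H^n}|f(z,t)|^2\,dz\,dt=\int_\Omega\int_{\mathbb C^n}|\widehat f(a,w)|^2\,dw\,d\nu(a).$$ -/

import Mathlib

open MeasureTheory
open scoped SchwartzMap Nat

noncomputable section

namespace Strichartz

/-- `ℂⁿ` with its Hermitian norm; `volume` is Lebesgue measure on `ℂⁿ = ℝ²ⁿ`. -/
abbrev Cn (n : ℕ) : Type := EuclideanSpace ℂ (Fin n)

/-- The underlying space `ℂⁿ × ℝ` of the Heisenberg group `ℍⁿ`; `volume` is Lebesgue measure
`dz dt`, which is the Haar measure, and `𝓢(Heis n, ℂ)` is the usual Schwartz space. -/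
abbrev Heis (n : ℕ) : Type := Cn n × ℝ

/-- The group law `(z, t)(w, s) = (z + w, t + s + ½ Im (z · w̄))` of `ℍⁿ`. -/
def heisMul {n : ℕ} (p q : Heis n) : Heis n :=
  (p.1 + q.1, p.2 + q.2 + 1 / 2 * (∑ i, p.1 i * starRingEnd ℂ (q.1 i)).im)

/-- The inverse `(z, t)⁻¹ = (-z, -t)` in `ℍⁿ`. -/
def heisInv {n : ℕ} (p : Heis n) : Heis n := (-p.1, -p.2)

/-- The Laguerre polynomial `L_k^δ(x) = ∑_{j ≤ k} (-1)^j binom(k + δ, k - j) x^j / j!`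
of type `δ ∈ ℕ`. -/
def laguerre (δ k : ℕ) (x : ℝ) : ℝ :=
  ∑ j ∈ Finset.range (k + 1), (-1) ^ j * ((k + δ).choose (k - j) : ℝ) * x ^ j / (j ! : ℝ)

/-- The Laguerre function `φ_{k,λ}^{n-1}(z) = L_k^{n-1}(½ |λ| |z|²) exp(-¼ |λ| |z|²)`. -/
def laguerreFun (n k : ℕ) (l : ℝ) (z : Cn n) : ℝ :=
  laguerre (n - 1) k (1 / 2 * |l| * ‖z‖ ^ 2) * Real.exp (-(1 / 4 * |l| * ‖z‖ ^ 2))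

/-- `e_{k,λ}^{n-1}(z, t) = exp(i λ t) φ_{k,λ}^{n-1}(z)`. -/
def eKL (n k : ℕ) (l : ℝ) (p : Heis n) : ℂ :=
  Complex.exp (Complex.I * l * p.2) * (laguerreFun n k l p.1 : ℂ)

/-- The Bessel function `J_m` of integer order `m ≥ 0`. -/
def besselJ (m : ℕ) (x : ℝ) : ℝ :=
  ∑' j : ℕ, (-1) ^ j / ((j ! : ℝ) * ((j + m)! : ℝ)) * (x / 2) ^ (2 * j + m)

/-- `m! 2^m J_m(x) / x^m`, extended continuously by the value `1` at `x = 0`. -/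
def besselNorm (m : ℕ) (x : ℝ) : ℝ :=
  if x = 0 then 1 else (m ! : ℝ) * 2 ^ m * (besselJ m x / x ^ m)

/-- The Heisenberg fan `Ω ⊆ ℝ²`: the rays `R_k = {(λ, τ) : τ = (2k + n)|λ|}`, `k = 0, 1, 2, …`,
and the limiting ray `R_∞ = {(0, τ) : τ ≥ 0}`. -/
def fan (n : ℕ) : Set (ℝ × ℝ) :=
  {a | ∃ k : ℕ, a.2 = (2 * k + n) * |a.1|} ∪ {a | a.1 = 0 ∧ 0 ≤ a.2}

/-- The parametrization `λ ↦ (λ, (2k + n)|λ|)` of the ray `R_k`. -/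
def ray (n k : ℕ) (l : ℝ) : fan n :=
  ⟨(l, (2 * k + n) * |l|), Or.inl ⟨k, rfl⟩⟩

/-- The index `k` with `a ∈ R_k`; it is unique for `a = (λ, τ) ∈ Ω` with `λ ≠ 0`. -/
def fanIndex {n : ℕ} (a : fan n) : ℕ :=
  sInf {k : ℕ | a.1.2 = (2 * k + n) * |a.1.1|}

theorem fanIndex_ray (n k : ℕ) {l : ℝ} (hl : l ≠ 0) : fanIndex (ray n k l) = k := by
  have h : {j : ℕ | (ray n k l).1.2 = (2 * j + n) * |(ray n k l).1.1|} = {k} := by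
    ext j
    have hl' : |l| ≠ 0 := abs_ne_zero.mpr hl
    simp only [ray, Set.mem_ofPred_eq, Set.mem_singleton_iff]
    constructor
    · intro h
      have h2 := mul_right_cancel₀ hl' h
      have h3 : (k : ℝ) = j := by linarith
      exact_mod_cast h3.symm
    · rintro rfl
      rfl
  rw [fanIndex, h, csInf_singleton]

/-- The functions `e_a` on `ℍⁿ` for `a = (λ, τ) ∈ Ω`: `e_a = e_{k,λ}^{n-1}` for `a ∈ R_k`, `λ ≠ 0`,
and `e_{(0,τ)}(z, t) = (n-1)! 2^{n-1} J_{n-1}(√τ |z|) / (√τ |z|)^{n-1}` on the limiting ray. -/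
def eFan {n : ℕ} (a : fan n) (p : Heis n) : ℂ :=
  if a.1.1 = 0 then (besselNorm (n - 1) (√a.1.2 * ‖p.1‖) : ℂ)
  else eKL n (fanIndex a) a.1.1 p

/-- The Strichartz Fourier transform `f̂(a, z) = ∫_{ℍⁿ} f(w, s) e_a((w, s)⁻¹ (z, 0)) dw ds`. -/
def strichartzTransform {n : ℕ} (f : Heis n → ℂ) (a : fan n) (z : Cn n) : ℂ :=
  ∫ p : Heis n, f p * eFan a (heisMul (heisInv p) (z, 0))

/-- The measure `ν` on the fan,
`∫_Ω φ dν = (2π)^{-2n-1} ∫_ℝ ∑_k φ(λ, (2k + n)|λ|) |λ|^{2n} dλ`: the sum over `k` of the images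
of `(2π)^{-2n-1} |λ|^{2n} dλ` under `λ ↦ (λ, (2k + n)|λ|)`. -/
def fanMeasure (n : ℕ) : Measure (fan n) :=
  Measure.sum fun k : ℕ =>
    ((volume : Measure ℝ).withDensity fun l =>
      ENNReal.ofReal (((2 * Real.pi) ^ (2 * n + 1))⁻¹ * |l| ^ (2 * n))).map (ray n k)

end Strichartz

end

open Strichartz

/-! Write `f^λ` for the Fourier transform of `f` in the central variable and `φ_k` for the Laguerre
function with parameter `λ`. On the ray `R_k`, at `λ ≠ 0`, the Strichartz transform is the
`λ`-twisted convolution `f^λ × φ_k` (`strichartzTransform_ray`). The limiting ray is `ν`-null, so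
the Bessel functions never contribute. With `c = (2π/|λ|)^n`, everything rests on two facts: `φ_k ×
φ_k = c φ_k`, and `∑_k F × φ_k = c F`. In other words, the operators `c⁻¹ (· × φ_k)` are orthogonal
projections adding up to the identity.

Both facts come from the generating function `∑ r^k φ_k` (`mehler`), which is a Gaussian. Twisted
convolutions of Gaussians are explicit and give `mehler r × mehler s = c · mehler (r s)`
(`twistedConv_mehler`); comparing coefficients of powers gives the idempotency
(`twistedConv_laguerreFun_self`). As `r → 1`, `mehler r` is `c` times an approximate identity
(`tendsto_integral_mehler_mul`), so the second fact holds in the sense of Abel summation.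

For Plancherel, `‖F × φ_k‖² = c ⟨F × φ_k, F⟩ ≥ 0`, and nonnegative Abel summable series converge, so
`∑_k ‖F × φ_k‖² = c² ‖F‖²`. The density of `ν` turns `c²` into `(2π)⁻¹`, and the one-dimensional
Plancherel theorem in `λ` finishes the proof.

For inversion, the inner integral is `e^{iλt} (f^λ × φ_k) × φ_k = c e^{iλt} f^λ × φ_k`. Summing over
`k` and integrating in `λ` is one-dimensional Fourier inversion. Absolute convergence comes from the
sublaplacian: `e_{k,λ}` is an eigenfunction with eigenvalue `(2k+n)|λ|`, so the transform of a
Schwartz function decays rapidly in that quantity (`exists_norm_strichartzTransform_ray_le`). -/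

noncomputable section

namespace Strichartz

/-! ### Laguerre polynomials: generating function and differential equation. -/

section

/-- Expand the exponential in powers of `-xr/(1-r)` and each `(1-r)^{-(j+δ+1)}` as a binomial
series; the antidiagonals of the double series are the Laguerre polynomials. Taking norms replaces
`(-x, r)` by `(|x|, |r|)`, which gives absolute convergence. -/
theorem hasSum_laguerre_mul_pow (δ : ℕ) (x : ℝ) {r : ℝ} (hr : |r| < 1) :
    HasSum (fun k => laguerre δ k x * r ^ k) (Real.exp (-(x * r / (1 - r))) / (1 - r) ^ (δ + 1)) := by
  let a : ℝ → ℝ → ℕ × ℕ → ℝ := fun y s p =>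
    (y * s) ^ p.1 / (p.1 ! : ℝ) * (((p.2 + (p.1 + δ)).choose (p.1 + δ) : ℝ) * s ^ p.2)
  have hcol : ∀ (y s : ℝ), |s| < 1 → ∀ j, HasSum (fun m => a y s (j, m))
      ((y * s / (1 - s)) ^ j / (j ! : ℝ) * (1 / (1 - s) ^ (δ + 1))) := by
    intro y s hs j
    have h := (hasSum_choose_mul_geometric_of_norm_lt_one (𝕜 := ℝ) (j + δ)
      (r := s) (by simpa using hs)).mul_left ((y * s) ^ j / (j ! : ℝ))
    have hs' : (1 - s) ≠ 0 := by
      have := (abs_lt.1 hs).2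
      linarith
    have e : (y * s / (1 - s)) ^ j / (j ! : ℝ) * (1 / (1 - s) ^ (δ + 1)) =
        (y * s) ^ j / (j ! : ℝ) * (1 / (1 - s) ^ (j + δ + 1)) := by
      rw [div_pow, add_assoc j δ 1, pow_add (1 - s) j]
      field_simp
    rw [e]
    exact h
  have hrow : ∀ (y s : ℝ), HasSum (fun j : ℕ => (y * s / (1 - s)) ^ j / (j ! : ℝ) *
      (1 / (1 - s) ^ (δ + 1))) (Real.exp (y * s / (1 - s)) * (1 / (1 - s) ^ (δ + 1))) := by
    intro y s
    have h := NormedSpace.expSeries_div_hasSum_exp (𝔸 := ℝ) (y * s / (1 - s))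
    rw [← Real.exp_eq_exp_ℝ] at h
    exact h.mul_right _
  have hsum : Summable (a (-x) r) := by
    refine Summable.of_norm ?_
    have hs : |(|r|)| < 1 := by simpa using hr
    have : (fun p => ‖a (-x) r p‖) = a |x| |r| := by
      funext p
      simp [a]
    rw [this]
    have hnn : 0 ≤ a |x| |r| := fun p => by positivity
    refine (summable_prod_of_nonneg hnn).2 ⟨fun j => (hcol _ _ hs j).summable, ?_⟩
    simp_rw [(hcol |x| |r| hs _).tsum_eq]
    exact (hrow |x| |r|).summable
  have htot : HasSum (a (-x) r) (Real.exp (-x * r / (1 - r)) * (1 / (1 - r) ^ (δ + 1))) := by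
    have h1 := hsum.hasSum
    have h2 := h1.prod_fiberwise (fun j => hcol (-x) r hr j)
    rwa [h2.unique (hrow (-x) r)] at h1
  have h3 := (Finset.HasAntidiagonal.sigmaAntidiagonalEquivProd (A := ℕ)).hasSum_iff.2 htot
  have h4 := h3.sigma (g := fun k => laguerre δ k x * r ^ k) (fun k => by
    have h := hasSum_fintype (fun p : (Finset.HasAntidiagonal.antidiagonal k) => a (-x) r p)
    suffices e : laguerre δ k x * r ^ k =
        ∑ b : Finset.HasAntidiagonal.antidiagonal k, a (-x) r b by
      rw [e]
      exact h
    rw [Finset.univ_eq_attach,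
      Finset.sum_attach (Finset.HasAntidiagonal.antidiagonal k) (fun p => a (-x) r p),
      Finset.Nat.sum_antidiagonal_eq_sum_range_succ_mk, laguerre, Finset.sum_mul]
    refine Finset.sum_congr rfl fun j hj => ?_
    have hjk : j ≤ k := Nat.lt_succ_iff.1 (Finset.mem_range.1 hj)
    have e1 : k - j + (j + δ) = k + δ := by omega
    have e2 : (k + δ).choose (k - j) = (k + δ).choose (j + δ) := by
      rw [← Nat.choose_symm (by omega)]
      congr 1
      omega
    simp only [a, e1, e2]
    have e3 : r ^ k = r ^ j * r ^ (k - j) := by rw [← pow_add]; congr 1; omega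
    rw [e3, neg_mul, neg_pow (x * r), mul_pow]
    ring)
  convert h4 using 1
  rw [mul_one_div]
  congr 2
  ring

/-- At `-x` the alternating signs disappear. This majorant still has an explicit generating
function. -/
theorem abs_laguerre_le (δ k : ℕ) {x : ℝ} (hx : 0 ≤ x) : |laguerre δ k x| ≤ laguerre δ k (-x) := by
  unfold laguerre
  refine (Finset.abs_sum_le_sum_abs _ _).trans (Finset.sum_le_sum fun j _ => ?_)
  have e : (-1 : ℝ) ^ j * ((k + δ).choose (k - j) : ℝ) * (-x) ^ j / (j ! : ℝ) =
      ((k + δ).choose (k - j) : ℝ) * x ^ j / (j ! : ℝ) := by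
    rw [neg_pow x, mul_mul_mul_comm, mul_comm ((-1 : ℝ) ^ j), mul_assoc _ ((-1 : ℝ) ^ j),
      ← mul_assoc ((-1 : ℝ) ^ j), ← mul_pow]
    simp
  rw [e]
  simp [abs_mul, abs_div, abs_of_nonneg hx]

theorem laguerre_zero_right (δ k : ℕ) : laguerre δ k 0 = ((k + δ).choose k : ℝ) := by
  unfold laguerre
  rw [Finset.sum_eq_single 0] <;> simp +contextual

theorem continuous_laguerre (δ k : ℕ) : Continuous (laguerre δ k) := by
  unfold laguerre
  fun_prop

/-- Two power series with the same sum near `0` have the same coefficients. -/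
theorem eq_of_hasSum_mul_pow {a b : ℕ → ℂ} {S : ℝ → ℂ} {ε : ℝ} (hε : 0 < ε)
    (ha : ∀ r : ℝ, |r| < ε → HasSum (fun k => a k * (r : ℂ) ^ k) (S r))
    (hb : ∀ r : ℝ, |r| < ε → HasSum (fun k => b k * (r : ℂ) ^ k) (S r)) : a = b := by
  let p : (ℕ → ℂ) → FormalMultilinearSeries ℝ ℝ ℂ :=
    fun c k => ContinuousMultilinearMap.mkPiRing ℝ (Fin k) (c k)
  have key : ∀ c : ℕ → ℂ, (∀ r : ℝ, |r| < ε → HasSum (fun k => c k * (r : ℂ) ^ k) (S r)) →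
      HasFPowerSeriesAt S (p c) 0 := by
    intro c hc
    rw [hasFPowerSeriesAt_iff]
    filter_upwards [Metric.ball_mem_nhds (0 : ℝ) hε] with r hr
    have := hc r (by simpa using hr)
    simpa [p, FormalMultilinearSeries.coeff, mul_comm] using this
  have h := (key a ha).eq_formalMultilinearSeries (key b hb)
  funext k
  have := congrArg (fun q => q (fun _ => 1)) (congrFun h k)
  simpa [p] using this

/-- The Laguerre polynomial of type `δ` as an element of `ℝ[X]`. -/
def laguerrePoly (δ k : ℕ) : Polynomial ℝ :=
  ∑ j ∈ Finset.range (k + 1),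
    Polynomial.C ((-1) ^ j * ((k + δ).choose (k - j) : ℝ) / (j ! : ℝ)) * Polynomial.X ^ j

theorem eval_laguerrePoly (δ k : ℕ) (x : ℝ) : (laguerrePoly δ k).eval x = laguerre δ k x := by
  unfold laguerrePoly laguerre
  rw [Polynomial.eval_finsetSum]
  refine Finset.sum_congr rfl fun j _ => ?_
  simp only [Polynomial.eval_mul, Polynomial.eval_C, Polynomial.eval_pow, Polynomial.eval_X]
  ring

theorem coeff_laguerrePoly (δ k j : ℕ) : (laguerrePoly δ k).coeff j =
    if j < k + 1 then (-1) ^ j * ((k + δ).choose (k - j) : ℝ) / (j ! : ℝ) else 0 := by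
  unfold laguerrePoly
  simp only [Polynomial.finsetSum_coeff, Polynomial.coeff_C_mul_X_pow, Finset.sum_ite_eq,
    Finset.mem_range]

/-- The Laguerre differential equation `x L'' + (δ + 1 - x) L' + k L = 0`. -/
theorem laguerrePoly_ode (δ k : ℕ) :
    Polynomial.X * (laguerrePoly δ k).derivative.derivative +
      (Polynomial.C ((δ : ℝ) + 1) - Polynomial.X) * (laguerrePoly δ k).derivative +
      Polynomial.C (k : ℝ) * laguerrePoly δ k = 0 := by
  -- Coefficientwise the equation is this two-term recursion; at `j = k` the factor `k - j`
  -- vanishes, where the polynomial stops.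
  have hrec : ∀ j, (laguerrePoly δ k).coeff (j + 1) * ((j + 1) * (j + 1 + δ)) =
      -(k - j) * (laguerrePoly δ k).coeff j := by
    intro j
    simp only [coeff_laguerrePoly]
    rcases lt_trichotomy j k with h | h | h
    · rw [if_pos (by omega), if_pos (by omega)]
      have h1 := Nat.choose_succ_right_eq (k + δ) (k - (j + 1))
      rw [show k - (j + 1) + 1 = k - j by omega,
        show k + δ - (k - (j + 1)) = j + 1 + δ by omega] at h1
      have h2 : ((k + δ).choose (k - j) : ℝ) * (k - j) =
          (k + δ).choose (k - (j + 1)) * (j + 1 + δ) := by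
        rw [← Nat.cast_sub h.le]
        exact_mod_cast h1
      have h3 : (((j + 1)! : ℕ) : ℝ) = (j + 1) * (j ! : ℝ) := by
        rw [Nat.factorial_succ]
        push_cast
        ring
      have h4 : (j ! : ℝ) ≠ 0 := by positivity
      have h5 : (j + 1 : ℝ) ≠ 0 := by positivity
      rw [h3]
      field_simp
      rw [pow_succ]
      linear_combination (-1 : ℝ) ^ j * h2
    · subst h
      rw [if_neg (by omega)]
      simp
    · rw [if_neg (by omega), if_neg (by omega)]
      simp
  ext j
  cases j with
  | zero =>
    have := hrec 0
    simp only [Polynomial.coeff_add, Polynomial.coeff_zero, Polynomial.coeff_X_mul_zero, sub_mul,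
      Polynomial.coeff_sub, Polynomial.coeff_C_mul, Polynomial.coeff_derivative]
    push_cast at this ⊢
    linear_combination this
  | succ j =>
    have := hrec (j + 1)
    simp only [Polynomial.coeff_add, Polynomial.coeff_zero, Polynomial.coeff_X_mul, sub_mul,
      Polynomial.coeff_sub, Polynomial.coeff_C_mul, Polynomial.coeff_derivative]
    push_cast at this ⊢
    linear_combination this

end

/-! ### Twisted convolution and the Gaussian generating function. -/

section

variable {n : ℕ}

theorem HasSum.of_eq {α : Type*} [AddCommMonoid α] [TopologicalSpace α] {f g : ℕ → α} {a b : α}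
    (h : HasSum f a) (hfg : ∀ k, f k = g k) (hab : a = b) : HasSum g b :=
  hab ▸ (funext hfg : f = g) ▸ h

/-- The symplectic form `Im (w · z̄)` on `ℂⁿ`. -/
def symp (w z : Cn n) : ℝ := (∑ i, w i * starRingEnd ℂ (z i)).im

/-- Bilinearity, continuity and growth of the form are inherited from the real inner product. -/
theorem symp_eq_inner (w z : Cn n) : symp w z = inner ℝ (Complex.I • z) w := by
  simp only [symp, PiLp.inner_apply, Complex.im_sum]
  refine Finset.sum_congr rfl fun i _ => ?_
  rw [Complex.inner]
  simp
  ring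

theorem symp_add_left (a b z : Cn n) : symp (a + b) z = symp a z + symp b z := by
  simp [symp_eq_inner, inner_add_right]

theorem symp_add_right (w a b : Cn n) : symp w (a + b) = symp w a + symp w b := by
  simp [symp_eq_inner, inner_add_left]

theorem symp_swap (w z : Cn n) : symp w z = -symp z w := by
  simp only [symp, Complex.im_sum, ← Finset.sum_neg_distrib]
  refine Finset.sum_congr rfl fun i _ => ?_
  simp
  ring

theorem symp_self (z : Cn n) : symp z z = 0 := by
  have := symp_swap z z
  linarith

theorem symp_neg_left (a z : Cn n) : symp (-a) z = -symp a z := by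
  simp [symp_eq_inner]

theorem symp_neg_right (a z : Cn n) : symp a (-z) = -symp a z := by
  simp [symp_eq_inner]

theorem symp_sub_left (a b z : Cn n) : symp (a - b) z = symp a z - symp b z := by
  rw [sub_eq_add_neg, symp_add_left, symp_neg_left, sub_eq_add_neg]

theorem symp_sub_right (w a b : Cn n) : symp w (a - b) = symp w a - symp w b := by
  rw [sub_eq_add_neg, symp_add_right, symp_neg_right, sub_eq_add_neg]

theorem symp_smul_left (t : ℝ) (a z : Cn n) : symp (t • a) z = t * symp a z := by
  simp [symp_eq_inner, inner_smul_right]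

@[fun_prop]
theorem Continuous.symp {X : Type*} [TopologicalSpace X] {f g : X → Cn n}
    (hf : Continuous f) (hg : Continuous g) : Continuous fun x => symp (f x) (g x) := by
  simp only [symp_eq_inner]
  fun_prop

/-- The phase `exp(-(iλ/2) Im (w · z̄))` of the `λ`-twisted convolution. -/
def twist (l : ℝ) (w z : Cn n) : ℂ := Complex.exp ((-(l / 2 * symp w z) : ℝ) * Complex.I)

@[simp]
theorem norm_twist (l : ℝ) (w z : Cn n) : ‖twist l w z‖ = 1 := Complex.norm_exp_ofReal_mul_I _

@[fun_prop]
theorem Continuous.twist {X : Type*} [TopologicalSpace X] {l : X → ℝ} {f g : X → Cn n}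
    (hl : Continuous l) (hf : Continuous f) (hg : Continuous g) :
    Continuous fun x => twist (l x) (f x) (g x) := by
  unfold Strichartz.twist
  fun_prop

theorem twist_neg (l : ℝ) (w z : Cn n) : twist (-l) w z = twist l z w := by
  unfold twist
  rw [symp_swap w z]
  congr 3
  ring

theorem conj_twist (l : ℝ) (w z : Cn n) : starRingEnd ℂ (twist l w z) = twist l z w := by
  unfold twist
  rw [← Complex.exp_conj, symp_swap w z, map_mul, Complex.conj_ofReal, Complex.conj_I, mul_neg,
    ← neg_mul, ← Complex.ofReal_neg]
  congr 3
  ring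

/-- The `λ`-twisted convolution on `ℂⁿ`. -/
def twistedConv (l : ℝ) (F Φ : Cn n → ℂ) (z : Cn n) : ℂ :=
  ∫ w, F w * Φ (z - w) * twist l w z

/-- The substitution `w ↦ z - w` reverses the sign of the phase. For kernels depending only on `|λ|`
this exchanges the two factors freely. -/
theorem twistedConv_comm (l : ℝ) (F Φ : Cn n → ℂ) (z : Cn n) :
    twistedConv l F Φ z = twistedConv (-l) Φ F z := by
  unfold twistedConv
  rw [← integral_sub_left_eq_self _ volume z]
  congr 1
  funext w
  rw [sub_sub_cancel, twist_neg, mul_comm (F _)]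
  congr 1
  unfold twist
  rw [symp_sub_left, symp_self, symp_swap w z]
  congr 3
  ring

theorem finrank_Cn : Module.finrank ℝ (Cn n) = 2 * n := by
  rw [← Module.finrank_mul_finrank ℝ ℂ (Cn n)]
  simp

/-- In `w` the twist is a character with frequency proportional to `I • z`, so this is the Fourier
transform of a Gaussian in real dimension `2n`. -/
theorem integral_gaussian_mul_twist {a : ℝ} (ha : 0 < a) (l : ℝ) (z : Cn n) :
    ∫ w : Cn n, (Real.exp (-a * ‖w‖ ^ 2) : ℂ) * twist l w z =
      (Real.pi / a) ^ n * Real.exp (-(l ^ 2 / (16 * a)) * ‖z‖ ^ 2) := by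
  have h := GaussianFourier.integral_cexp_neg_mul_sq_norm_add (V := Cn n) (b := (a : ℂ))
    (by simpa using ha) (-(l / 2) * Complex.I) (Complex.I • z)
  rw [norm_smul, Complex.norm_I, one_mul, finrank_Cn] at h
  have e : ((2 * n : ℕ) : ℂ) / 2 = (n : ℕ) := by push_cast; ring
  rw [e, Complex.cpow_natCast] at h
  rw [Complex.ofReal_exp]
  convert h using 2
  · funext w
    rw [Complex.ofReal_exp, twist, ← Complex.exp_add, symp_eq_inner]
    congr 1
    push_cast
    ring
  · congr 1
    rw [mul_pow, Complex.I_sq]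
    push_cast
    ring

theorem twistedConv_gaussian {a b : ℝ} (ha : 0 < a) (hb : 0 < b) (l : ℝ) (z : Cn n) :
    twistedConv l (fun w => (Real.exp (-a * ‖w‖ ^ 2) : ℂ))
      (fun w => (Real.exp (-b * ‖w‖ ^ 2) : ℂ)) z =
      (Real.pi / (a + b) : ℝ) ^ n *
        Real.exp (-((a * b + l ^ 2 / 16) / (a + b)) * ‖z‖ ^ 2) := by
  have hab : 0 < a + b := by linarith
  unfold twistedConv
  -- This shift completes the square; the twist does not see it, because `symp z z = 0`.
  rw [← integral_add_right_eq_self _ ((b / (a + b)) • z)]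
  have key : ∀ w : Cn n, (Real.exp (-a * ‖w + (b / (a + b)) • z‖ ^ 2) : ℂ) *
      (Real.exp (-b * ‖z - (w + (b / (a + b)) • z)‖ ^ 2) : ℂ) *
      twist l (w + (b / (a + b)) • z) z =
      (Real.exp (-(a * b / (a + b)) * ‖z‖ ^ 2) : ℂ) *
        ((Real.exp (-(a + b) * ‖w‖ ^ 2) : ℂ) * twist l w z) := by
    intro w
    have e1 : twist l (w + (b / (a + b)) • z) z = twist l w z := by
      simp [twist, symp_add_left, symp_smul_left, symp_self]
    rw [e1, ← mul_assoc]
    congr 1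
    rw [← Complex.ofReal_mul, ← Complex.ofReal_mul, ← Real.exp_add, ← Real.exp_add]
    congr 2
    have e2 : z - (w + (b / (a + b)) • z) = (a / (a + b)) • z - w := by
      have : a / (a + b) = 1 - b / (a + b) := by field_simp; ring
      rw [this, sub_smul, one_smul]
      abel
    rw [e2, norm_sub_sq_real, norm_add_sq_real, norm_smul, norm_smul, inner_smul_left,
      inner_smul_right, real_inner_comm w z, mul_pow, mul_pow, Real.norm_eq_abs, Real.norm_eq_abs,
      sq_abs, sq_abs]
    simp only [conj_trivial]
    field_simp
    ring
  simp_rw [key]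
  rw [integral_const_mul, integral_gaussian_mul_twist hab]
  rw [mul_left_comm, ← Complex.ofReal_mul, ← Real.exp_add]
  push_cast
  congr 3
  field_simp
  ring

/-- The generating function `∑ r^k φ_{k,λ}^{n-1}(z)` of the Laguerre functions. -/
def mehler (n : ℕ) (l r : ℝ) (z : Cn n) : ℝ :=
  Real.exp (-(1 / 4 * |l| * ((1 + r) / (1 - r))) * ‖z‖ ^ 2) / (1 - r) ^ n

theorem hasSum_laguerreFun (hn : 1 ≤ n) (l : ℝ) (z : Cn n) {r : ℝ} (hr : |r| < 1) :
    HasSum (fun k => laguerreFun n k l z * r ^ k) (mehler n l r z) := by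
  have h := (hasSum_laguerre_mul_pow (n - 1) (1 / 2 * |l| * ‖z‖ ^ 2) hr).mul_right
    (Real.exp (-(1 / 4 * |l| * ‖z‖ ^ 2)))
  have hr' : (1 - r) ≠ 0 := by
    have := (abs_lt.1 hr).2
    linarith
  refine HasSum.of_eq h (fun k => ?_) ?_
  · unfold laguerreFun
    ring
  · rw [mehler, div_mul_eq_mul_div, ← Real.exp_add, Nat.sub_add_cancel hn]
    congr 2
    field_simp
    ring

/-- The majorant `L_k^{n-1}(-x) e^{-x/2}`, `x = |λ||z|²/2`, of `|φ_{k,λ}^{n-1}(z)|`. -/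
def laguerreMaj (n k : ℕ) (l : ℝ) (z : Cn n) : ℝ :=
  laguerre (n - 1) k (-(1 / 2 * |l| * ‖z‖ ^ 2)) * Real.exp (-(1 / 4 * |l| * ‖z‖ ^ 2))

theorem abs_laguerreFun_le (k : ℕ) (l : ℝ) (z : Cn n) :
    |laguerreFun n k l z| ≤ laguerreMaj n k l z := by
  unfold laguerreFun laguerreMaj
  rw [abs_mul, Real.abs_exp]
  gcongr
  exact abs_laguerre_le _ _ (by positivity)

theorem laguerreMaj_nonneg (k : ℕ) (l : ℝ) (z : Cn n) : 0 ≤ laguerreMaj n k l z :=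
  (abs_nonneg _).trans (abs_laguerreFun_le k l z)

/-- For `r < 1` the exponent is nonpositive exactly when `r ≤ 1/3`, the source of the radius `1/3`
below. -/
theorem hasSum_laguerreMaj (hn : 1 ≤ n) (l : ℝ) (z : Cn n) {r : ℝ} (hr : |r| < 1) :
    HasSum (fun k => laguerreMaj n k l z * r ^ k)
      (Real.exp (1 / 2 * |l| * ‖z‖ ^ 2 * (r / (1 - r) - 1 / 2)) / (1 - r) ^ n) := by
  have h := (hasSum_laguerre_mul_pow (n - 1) (-(1 / 2 * |l| * ‖z‖ ^ 2)) hr).mul_right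
    (Real.exp (-(1 / 4 * |l| * ‖z‖ ^ 2)))
  refine HasSum.of_eq h (fun k => ?_) ?_
  · unfold laguerreMaj
    ring
  · rw [div_mul_eq_mul_div, ← Real.exp_add, Nat.sub_add_cancel hn]
    congr 2
    ring

theorem continuous_laguerreFun_right (k : ℕ) (l : ℝ) : Continuous (laguerreFun n k l) := by
  unfold laguerreFun
  have := continuous_laguerre (n - 1) k
  fun_prop

theorem continuous_mehler (l r : ℝ) : Continuous (mehler n l r) := by
  unfold mehler
  fun_prop

theorem integrable_gaussian {a : ℝ} (ha : 0 < a) :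
    Integrable fun z : Cn n => Real.exp (-a * ‖z‖ ^ 2) := by
  have h := (GaussianFourier.integrable_cexp_neg_mul_sq_norm_add (V := Cn n) (b := (a : ℂ))
    (by simpa using ha) 0 0).norm
  refine h.congr (Filter.Eventually.of_forall fun z => ?_)
  simp only [Complex.norm_exp]
  congr 1
  simp [← Complex.ofReal_pow]

theorem integrable_laguerreFun (hn : 1 ≤ n) (k : ℕ) {l : ℝ} (hl : l ≠ 0) :
    Integrable (laguerreFun n k l) := by
  have hl' : 0 < |l| := abs_pos.2 hl
  have h := (integrable_gaussian (n := n) (a := 1 / 8 * |l|) (by positivity)).mul_const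
    (5 ^ k * (5 / 4) ^ n)
  refine h.mono' (continuous_laguerreFun_right k l).aestronglyMeasurable
    (Filter.Eventually.of_forall fun z => ?_)
  -- At `r = 1/5` the exponent is `-|λ||z|²/8`. A single term of a nonnegative series is at most its
  -- sum, and the factor `5 ^ k` undoes `r ^ k`.
  have hs := hasSum_laguerreMaj hn l z (r := 1 / 5) (by norm_num [abs_lt])
  have h1 := le_hasSum hs k fun j _ => mul_nonneg (laguerreMaj_nonneg j l z) (by positivity)
  have h2 := abs_laguerreFun_le k l z
  rw [Real.norm_eq_abs]
  refine h2.trans ?_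
  have e : laguerreMaj n k l z = (laguerreMaj n k l z * (1 / 5) ^ k) * 5 ^ k := by
    rw [mul_assoc, ← mul_pow]
    norm_num
  rw [e]
  calc _ ≤ _ := mul_le_mul_of_nonneg_right h1 (by positivity)
    _ = _ := by
      rw [show (1 - 1 / 5 : ℝ) = (5 / 4)⁻¹ by norm_num, inv_pow, div_inv_eq_mul,
        show 1 / 2 * |l| * ‖z‖ ^ 2 * (1 / 5 / (5 / 4)⁻¹ - 1 / 2) = -(1 / 8 * |l|) * ‖z‖ ^ 2 by ring]
      ring

theorem integrable_mehler {l r : ℝ} (hl : l ≠ 0) (hr : |r| < 1) :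
    Integrable (mehler n l r) := by
  have h1 := (abs_lt.1 hr)
  refine (integrable_gaussian ?_).div_const _
  have : 0 < |l| := abs_pos.2 hl
  have : 0 < (1 + r) / (1 - r) := div_pos (by linarith) (by linarith)
  positivity

/-- The constant `(2π / |λ|)ⁿ`, the normalization of the twisted convolution algebra. -/
def twistConst (n : ℕ) (l : ℝ) : ℝ := (2 * Real.pi / |l|) ^ n

theorem twistConst_pos {l : ℝ} (hl : l ≠ 0) : 0 < twistConst n l := by
  have : 0 < |l| := abs_pos.2 hl
  unfold twistConst
  positivity

/-- For `r = e^{-2x}` with `x > 0` one has `(1 + r)/(1 - r) = coth x`, and the composition law of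
the Gaussians becomes the addition formula for `coth`. The algebra below holds for every `|r|, |s| <
1`. -/
theorem twistedConv_mehler {l r s : ℝ} (hl : l ≠ 0) (hr : |r| < 1) (hs : |s| < 1) (z : Cn n) :
    twistedConv l (fun w => (mehler n l r w : ℂ)) (fun w => (mehler n l s w : ℂ)) z =
      twistConst n l * mehler n l (r * s) z := by
  have hl' : 0 < |l| := abs_pos.2 hl
  have hr' := abs_lt.1 hr
  have hs' := abs_lt.1 hs
  have hrs : 0 < 1 - r * s := by
    have : |r * s| < 1 := by
      rw [abs_mul]
      exact mul_lt_one_of_nonneg_of_lt_one_left (abs_nonneg _) hr hs.le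
    linarith [(abs_lt.1 this).2]
  have h1r : 0 < 1 - r := by linarith
  have h1s : 0 < 1 - s := by linarith
  have ha : 0 < 1 / 4 * |l| * ((1 + r) / (1 - r)) := by
    have : 0 < (1 + r) / (1 - r) := div_pos (by linarith) (by linarith)
    positivity
  have hb : 0 < 1 / 4 * |l| * ((1 + s) / (1 - s)) := by
    have : 0 < (1 + s) / (1 - s) := div_pos (by linarith) (by linarith)
    positivity
  have h := twistedConv_gaussian ha hb l z
  have e : twistedConv l (fun w => (mehler n l r w : ℂ)) (fun w => (mehler n l s w : ℂ)) z =
      twistedConv l (fun w => (Real.exp (-(1 / 4 * |l| * ((1 + r) / (1 - r))) * ‖w‖ ^ 2) : ℂ))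
      (fun w => (Real.exp (-(1 / 4 * |l| * ((1 + s) / (1 - s))) * ‖w‖ ^ 2) : ℂ)) z *
        ((((1 - r) ^ n)⁻¹ * ((1 - s) ^ n)⁻¹ : ℝ) : ℂ) := by
    unfold twistedConv mehler
    rw [← integral_mul_const]
    congr 1
    funext w
    push_cast
    ring
  rw [e, h]
  have hsum : 1 / 4 * |l| * ((1 + r) / (1 - r)) + 1 / 4 * |l| * ((1 + s) / (1 - s)) =
      |l| / 2 * ((1 - r * s) / ((1 - r) * (1 - s))) := by
    field_simp
    ring
  rw [hsum]
  unfold twistConst mehler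
  have e2 : (1 / 4 * |l| * ((1 + r) / (1 - r)) * (1 / 4 * |l| * ((1 + s) / (1 - s))) + l ^ 2 / 16) /
      (|l| / 2 * ((1 - r * s) / ((1 - r) * (1 - s)))) =
      1 / 4 * |l| * ((1 + r * s) / (1 - r * s)) := by
    rw [← sq_abs l]
    field_simp
    ring
  rw [e2]
  norm_cast
  have e3 : Real.pi / (|l| / 2 * ((1 - r * s) / ((1 - r) * (1 - s)))) =
      (2 * Real.pi / |l|) * ((1 - r) * (1 - s)) / (1 - r * s) := by
    field_simp
  rw [e3, div_pow, mul_pow, mul_pow]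
  field_simp

/-- Twisted convolution with `∑ r^k φ_k` may be computed termwise. -/
theorem hasSum_twistedConv_laguerreFun (hn : 1 ≤ n) {l : ℝ} {F : Cn n → ℂ} (hF : Integrable F)
    {r : ℝ} (hr : |r| < 1) {b : ℕ → Cn n → ℝ} {B : Cn n → ℝ} {C : ℝ} (hB : Continuous B)
    (hφ : ∀ k w, |laguerreFun n k l w| ≤ b k w)
    (hs : ∀ w, HasSum (fun k => b k w * |r| ^ k) (B w)) (hC : ∀ w, B w ≤ C) (z : Cn n) :
    HasSum (fun k => twistedConv l F (fun w => (laguerreFun n k l w : ℂ)) z * (r : ℂ) ^ k)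
      (twistedConv l F (fun w => (mehler n l r w : ℂ)) z) := by
  unfold twistedConv
  have hb0 : ∀ k w, 0 ≤ b k w := fun k w => (abs_nonneg _).trans (hφ k w)
  simp_rw [← integral_mul_const]
  refine hasSum_integral_of_dominated_convergence
    (fun k w => ‖F w‖ * (b k (z - w) * |r| ^ k)) ?_ ?_ ?_ ?_ ?_
  · intro k
    have := continuous_laguerreFun_right (n := n) k l
    exact (((hF.aestronglyMeasurable).mul
      (by fun_prop : Continuous _).aestronglyMeasurable).mul
      (by fun_prop : Continuous _).aestronglyMeasurable).mul_const _
  · refine fun k => Filter.Eventually.of_forall fun w => ?_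
    rw [norm_mul, norm_mul, norm_mul, norm_twist, mul_one, mul_assoc, Complex.norm_real, norm_pow,
      Complex.norm_real, Real.norm_eq_abs, Real.norm_eq_abs]
    gcongr
    exact hφ _ _
  · exact Filter.Eventually.of_forall fun w => (hs _).summable.mul_left _
  · simp_rw [tsum_mul_left, (hs _).tsum_eq]
    refine (hF.norm.mul_const C).mono' ?_ (Filter.Eventually.of_forall fun w => ?_)
    · exact hF.norm.aestronglyMeasurable.mul
        (by fun_prop : Continuous fun w => B (z - w)).aestronglyMeasurable
    · have h0 : 0 ≤ B (z - w) :=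
        (hs (z - w)).nonneg fun k => mul_nonneg (hb0 _ _) (by positivity)
      rw [Real.norm_of_nonneg (by positivity)]
      gcongr
      exact hC _
  · refine Filter.Eventually.of_forall fun w => ?_
    have h := (Complex.hasSum_ofReal (L := .unconditional ℕ)).2 (hasSum_laguerreFun hn l (z - w) hr)
    have h2 := (h.mul_left (F w)).mul_right (twist l w z)
    refine HasSum.of_eq h2 (fun k => ?_) rfl
    push_cast
    ring

end

/-! ### Laguerre functions as idempotents of the twisted convolution algebra. -/

section

variable {n : ℕ}

theorem integrable_ofReal_laguerreFun (hn : 1 ≤ n) (k : ℕ) {l : ℝ} (hl : l ≠ 0) :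
    Integrable fun w : Cn n => (laguerreFun n k l w : ℂ) :=
  (integrable_laguerreFun hn k hl).ofReal

theorem integrable_ofReal_mehler {l r : ℝ} (hl : l ≠ 0) (hr : |r| < 1) :
    Integrable fun w : Cn n => (mehler n l r w : ℂ) :=
  (integrable_mehler hl hr).ofReal

/-- The crude majorant suffices for small `r`, which is enough to compare coefficients. The sharp
bound on `φ_k`, itself a consequence of idempotency, later gives all `|r| < 1`. -/
theorem hasSum_twistedConv_laguerreFun_of_small (hn : 1 ≤ n) {l : ℝ} {F : Cn n → ℂ}
    (hF : Integrable F) {r : ℝ} (hr : |r| < 1 / 3) (z : Cn n) :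
    HasSum (fun k => twistedConv l F (fun w => (laguerreFun n k l w : ℂ)) z * (r : ℂ) ^ k)
      (twistedConv l F (fun w => (mehler n l r w : ℂ)) z) := by
  have h1 : 0 < 1 - |r| := by linarith
  refine hasSum_twistedConv_laguerreFun hn hF (by linarith) (C := 1 / (1 - |r|) ^ n) ?_
    (fun k w => abs_laguerreFun_le k l w)
    (fun w => hasSum_laguerreMaj hn l w (r := |r|) (by rw [abs_abs]; linarith)) ?_ z
  · fun_prop
  · intro w
    gcongr
    rw [Real.exp_le_one_iff]
    refine mul_nonpos_of_nonneg_of_nonpos (by positivity) ?_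
    rw [sub_nonpos, div_le_div_iff₀ h1 two_pos]
    linarith

/-- Compare coefficients of `r ^ k` in `twistedConv_mehler`. -/
theorem twistedConv_mehler_laguerreFun (hn : 1 ≤ n) {l s : ℝ} (hl : l ≠ 0) (hs : |s| < 1) (k : ℕ)
    (z : Cn n) :
    twistedConv l (fun w => (mehler n l s w : ℂ)) (fun w => (laguerreFun n k l w : ℂ)) z =
      twistConst n l * s ^ k * laguerreFun n k l z := by
  have h := eq_of_hasSum_mul_pow (ε := 1 / 3) (by norm_num)
    (fun r hr => hasSum_twistedConv_laguerreFun_of_small hn (l := l)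
      (integrable_ofReal_mehler (n := n) hl hs) hr z)
    (b := fun k => twistConst n l * s ^ k * laguerreFun n k l z) (fun r hr => ?_)
  · exact congrFun h k
  · have hr1 : |r| < 1 := by linarith
    have hsr : |s * r| < 1 := by
      rw [abs_mul]
      exact mul_lt_one_of_nonneg_of_lt_one_left (abs_nonneg _) hs hr1.le
    have h2 := ((Complex.hasSum_ofReal (L := .unconditional ℕ)).2
      (hasSum_laguerreFun hn l z hsr)).mul_left (twistConst n l : ℂ)
    refine HasSum.of_eq h2 (fun j => ?_) ?_
    · push_cast
      ring
    · exact (twistedConv_mehler hl hs hr1 z).symm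

theorem laguerreFun_neg (k : ℕ) (l : ℝ) : laguerreFun n k (-l) = laguerreFun n k l := by
  unfold laguerreFun
  rw [abs_neg]

theorem mehler_neg (l r : ℝ) : mehler n (-l) r = mehler n l r := by
  unfold mehler
  rw [abs_neg]

/-- The Laguerre functions are multiples of idempotents for twisted convolution. -/
theorem twistedConv_laguerreFun_self (hn : 1 ≤ n) {l : ℝ} (hl : l ≠ 0) (k : ℕ) (z : Cn n) :
    twistedConv l (fun w => (laguerreFun n k l w : ℂ)) (fun w => (laguerreFun n k l w : ℂ)) z =
      twistConst n l * laguerreFun n k l z := by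
  have h := eq_of_hasSum_mul_pow (ε := 1 / 3) (by norm_num)
    (fun r hr => hasSum_twistedConv_laguerreFun_of_small hn (l := l)
      (integrable_ofReal_laguerreFun hn k hl) hr z)
    (b := fun j => if j = k then twistConst n l * laguerreFun n k l z else 0) (fun r hr => ?_)
  · simpa using congrFun h k
  -- Commuting the factors replaces `λ` by `-λ`, harmless since both depend on `|λ|` only. The
  -- result is a single monomial in `r`, so all other coefficients vanish.
  · have h1 : twistedConv l (fun w => (laguerreFun n k l w : ℂ)) (fun w => (mehler n l r w : ℂ)) z =
        twistConst n l * laguerreFun n k l z * r ^ k := by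
      have h3 := twistedConv_mehler_laguerreFun hn (neg_ne_zero.2 hl)
        (by linarith : |r| < 1) k z
      rw [twistedConv_comm]
      rw [laguerreFun_neg, mehler_neg] at h3
      rw [h3]
      unfold twistConst
      rw [abs_neg]
      ring
    rw [h1]
    have h2 := hasSum_ite_eq k ((twistConst n l : ℂ) * laguerreFun n k l z * r ^ k)
    refine HasSum.of_eq h2 (fun j => ?_) rfl
    split_ifs with h
    · rw [h]
    · simp

theorem laguerreFun_zero_right (k : ℕ) (l : ℝ) :
    laguerreFun n k l 0 = ((k + (n - 1)).choose k : ℝ) := by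
  simp [laguerreFun, laguerre_zero_right]

theorem laguerreFun_neg_right (k : ℕ) (l : ℝ) (z : Cn n) :
    laguerreFun n k l (-z) = laguerreFun n k l z := by
  simp [laguerreFun]

theorem integrable_sq_laguerreFun (hn : 1 ≤ n) (k : ℕ) {l : ℝ} (hl : l ≠ 0) :
    Integrable fun w : Cn n => laguerreFun n k l w ^ 2 := by
  have h := (integrable_laguerreFun (n := n) hn k hl)
  refine (h.norm.mul_const (5 ^ k * (5 / 4) ^ n)).mono'
    ((continuous_laguerreFun_right k l).pow 2).aestronglyMeasurable
    (Filter.Eventually.of_forall fun z => ?_)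
  rw [norm_pow, sq]
  refine mul_le_mul_of_nonneg_left ?_ (norm_nonneg _)
  have hs := hasSum_laguerreMaj hn l z (r := 1 / 5) (by norm_num [abs_lt])
  have h1 := le_hasSum hs k fun j _ => mul_nonneg (laguerreMaj_nonneg j l z) (by positivity)
  have h2 := abs_laguerreFun_le k l z
  rw [Real.norm_eq_abs]
  refine h2.trans ?_
  have e : laguerreMaj n k l z = 5 ^ k * (laguerreMaj n k l z * (1 / 5) ^ k) := by
    rw [mul_left_comm, ← mul_pow]
    norm_num
  rw [e]
  refine mul_le_mul_of_nonneg_left (h1.trans ?_) (by positivity)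
  rw [show (1 - 1 / 5 : ℝ) = (5 / 4)⁻¹ by norm_num, inv_pow, div_inv_eq_mul]
  refine mul_le_of_le_one_left (by positivity) ?_
  rw [Real.exp_le_one_iff]
  refine mul_nonpos_of_nonneg_of_nonpos (by positivity) (by norm_num)

/-- `|φ_{k,λ}^{n-1}(z)| ≤ φ_{k,λ}^{n-1}(0) = binom(k + n - 1, k)`. -/
theorem abs_laguerreFun_le_choose (hn : 1 ≤ n) (k : ℕ) {l : ℝ} (hl : l ≠ 0) (z : Cn n) :
    |laguerreFun n k l z| ≤ ((k + (n - 1)).choose k : ℝ) := by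
  have hsq := integrable_sq_laguerreFun (n := n) hn k hl
  -- Idempotency at the origin, where the twist is trivial and `φ_k` is even. At a general point the
  -- same integral is bounded through `ab ≤ (a² + b²)/2` and translation invariance.
  have h0 : twistConst n l * ((k + (n - 1)).choose k : ℝ) =
      ∫ w : Cn n, laguerreFun n k l w ^ 2 := by
    have h := twistedConv_laguerreFun_self hn hl k (0 : Cn n)
    rw [laguerreFun_zero_right] at h
    rw [← Complex.ofReal_inj, Complex.ofReal_mul, ← h, ← integral_complex_ofReal]
    unfold twistedConv
    congr 1
    funext w
    simp [twist, symp, laguerreFun_neg_right, sq]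
  have h1 : twistConst n l * |laguerreFun n k l z| ≤ ∫ w : Cn n, laguerreFun n k l w ^ 2 := by
    have h := twistedConv_laguerreFun_self hn hl k z
    have h2 := congrArg norm h
    rw [norm_mul, Complex.norm_real, Complex.norm_real, Real.norm_of_nonneg (twistConst_pos hl).le,
      Real.norm_eq_abs] at h2
    rw [← h2]
    have hsq' := hsq.comp_sub_left z
    have h3 : ∫ w : Cn n, (laguerreFun n k l w ^ 2 + laguerreFun n k l (z - w) ^ 2) / 2 =
        ∫ w : Cn n, laguerreFun n k l w ^ 2 := by
      rw [integral_div, integral_add hsq hsq',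
        integral_sub_left_eq_self (fun w => laguerreFun n k l w ^ 2) volume z]
      ring
    rw [← h3]
    refine norm_integral_le_of_norm_le ((hsq.add hsq').div_const 2)
      (Filter.Eventually.of_forall fun w => ?_)
    rw [norm_mul, norm_mul, norm_twist, mul_one, Complex.norm_real, Complex.norm_real,
      Real.norm_eq_abs, Real.norm_eq_abs]
    nlinarith [sq_nonneg (|laguerreFun n k l w| - |laguerreFun n k l (z - w)|),
      sq_abs (laguerreFun n k l w), sq_abs (laguerreFun n k l (z - w))]
  rw [← h0] at h1
  exact le_of_mul_le_mul_left h1 (twistConst_pos hl)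

/-- The binomial bound is uniform in `w` and has generating function `(1 - |r|)^{-n}`, so every `|r|
< 1` is allowed and `r → 1` becomes accessible. -/
theorem hasSum_twistedConv_laguerreFun_of_integrable (hn : 1 ≤ n) {l : ℝ} (hl : l ≠ 0)
    {F : Cn n → ℂ} (hF : Integrable F) {r : ℝ} (hr : |r| < 1) (z : Cn n) :
    HasSum (fun k => twistedConv l F (fun w => (laguerreFun n k l w : ℂ)) z * (r : ℂ) ^ k)
      (twistedConv l F (fun w => (mehler n l r w : ℂ)) z) := by
  have h := hasSum_choose_mul_geometric_of_norm_lt_one (𝕜 := ℝ) (n - 1) (r := |r|)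
    (by simpa using hr)
  refine hasSum_twistedConv_laguerreFun hn hF hr (B := fun _ => 1 / (1 - |r|) ^ (n - 1 + 1)) continuous_const
    (b := fun k _ => ((k + (n - 1)).choose k : ℝ))
    (fun k w => abs_laguerreFun_le_choose hn k hl w) (fun w => ?_) (fun w => le_rfl) z
  refine HasSum.of_eq h (fun k => ?_) rfl
  rw [Nat.choose_symm_add]

theorem integrable_twistedConv_integrand {l : ℝ} {F Φ : Cn n → ℂ} (hF : Integrable F)
    (hΦ : Continuous Φ) {C : ℝ} (hC : ∀ w, ‖Φ w‖ ≤ C) (z : Cn n) :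
    Integrable fun w => F w * Φ (z - w) * twist l w z := by
  refine (hF.norm.mul_const C).mono' ?_ (Filter.Eventually.of_forall fun w => ?_)
  · exact (hF.aestronglyMeasurable.mul (by fun_prop : Continuous _).aestronglyMeasurable).mul
      (by fun_prop : Continuous _).aestronglyMeasurable
  · rw [norm_mul, norm_mul, norm_twist, mul_one]
    gcongr
    exact hC _

theorem norm_twistedConv_le {l : ℝ} {F Φ : Cn n → ℂ} (hF : Integrable F)
    {C : ℝ} (hC : ∀ w, ‖Φ w‖ ≤ C) (z : Cn n) :
    ‖twistedConv l F Φ z‖ ≤ C * ∫ w, ‖F w‖ := by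
  rw [mul_comm, ← integral_mul_const]
  refine norm_integral_le_of_norm_le (hF.norm.mul_const C) (Filter.Eventually.of_forall fun w => ?_)
  rw [norm_mul, norm_mul, norm_twist, mul_one]
  gcongr
  exact hC _

/-- The kernel `F(y) A(w - y)` of a convolution of integrable functions is integrable. -/
theorem integrable_conv_kernel {F A : Cn n → ℂ} (hF : Integrable F) (hA : Integrable A) :
    Integrable (fun p : Cn n × Cn n => F p.2 * A (p.1 - p.2)) (volume.prod volume) :=
  hF.convolution_integrand (ContinuousLinearMap.mul ℝ ℂ) hA

theorem integrable_twistedConv {l : ℝ} {F A : Cn n → ℂ} (hF : Integrable F) (hA : Integrable A) :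
    Integrable (twistedConv l F A) := by
  have h : Integrable (fun p : Cn n × Cn n => F p.2 * A (p.1 - p.2) * twist l p.2 p.1)
      (volume.prod volume) := by
    refine (integrable_conv_kernel hF hA).norm.mono'
      ((integrable_conv_kernel hF hA).aestronglyMeasurable.mul
        (by fun_prop : Continuous _).aestronglyMeasurable)
      (Filter.Eventually.of_forall fun p => ?_)
    rw [norm_mul _ (twist _ _ _), norm_twist, mul_one]
  exact h.integral_prod_left

/-- After Fubini and the shift `w = u + y`, associativity reduces to the cocycle identity of the
phase, `e` below, which reflects associativity of the group law. -/
theorem twistedConv_assoc {l : ℝ} {F A B : Cn n → ℂ} (hF : Integrable F) (hA : Integrable A)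
    (hB : Continuous B) {C : ℝ} (hC : ∀ w, ‖B w‖ ≤ C) (z : Cn n) :
    twistedConv l (twistedConv l F A) B z = twistedConv l F (twistedConv l A B) z := by
  have hint : Integrable (fun p : Cn n × Cn n =>
      F p.2 * A (p.1 - p.2) * (twist l p.2 p.1 * B (z - p.1) * twist l p.1 z))
      (volume.prod volume) := by
    refine ((integrable_conv_kernel hF hA).norm.mul_const C).mono'
      ((integrable_conv_kernel hF hA).aestronglyMeasurable.mul
        (by fun_prop : Continuous _).aestronglyMeasurable)
      (Filter.Eventually.of_forall fun p => ?_)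
    rw [norm_mul _ (twist _ _ _ * _ * _), norm_mul _ (twist _ _ _), norm_mul (twist _ _ _),
      norm_twist, norm_twist, mul_one, one_mul]
    gcongr
    exact hC _
  unfold twistedConv
  simp_rw [← integral_mul_const]
  calc _ = ∫ w, ∫ y, F y * A (w - y) * (twist l y w * B (z - w) * twist l w z) := by
        congr 1; funext w; congr 1; funext y; ring
    _ = ∫ y, ∫ w, F y * A (w - y) * (twist l y w * B (z - w) * twist l w z) :=
        integral_integral_swap hint
    _ = _ := by
      congr 1
      funext y
      rw [← integral_const_mul, ← integral_mul_const, ← integral_add_right_eq_self _ y]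
      congr 1
      funext u
      have e : twist l y (u + y) * twist l (u + y) z = twist l u (z - y) * twist l y z := by
        unfold twist
        rw [← Complex.exp_add, ← Complex.exp_add, symp_add_right, symp_add_left, symp_sub_right,
          symp_self, symp_swap y u]
        congr 1
        push_cast
        ring
      rw [add_sub_cancel_right, sub_add_eq_sub_sub_swap]
      linear_combination F y * A u * B (z - y - u) * e

theorem norm_laguerreFun_le (hn : 1 ≤ n) (k : ℕ) {l : ℝ} (hl : l ≠ 0) (z : Cn n) :
    ‖(laguerreFun n k l z : ℂ)‖ ≤ ((k + (n - 1)).choose k : ℝ) := by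
  rw [Complex.norm_real]
  exact abs_laguerreFun_le_choose hn k hl z

/-- Associativity transfers the idempotency of `φ_k` to the operator `F ↦ F × φ_k`. -/
theorem twistedConv_twistedConv_laguerreFun (hn : 1 ≤ n) {l : ℝ} (hl : l ≠ 0) {F : Cn n → ℂ}
    (hF : Integrable F) (k : ℕ) (z : Cn n) :
    twistedConv l (twistedConv l F (fun w => (laguerreFun n k l w : ℂ)))
      (fun w => (laguerreFun n k l w : ℂ)) z =
      twistConst n l * twistedConv l F (fun w => (laguerreFun n k l w : ℂ)) z := by
  have hc := continuous_laguerreFun_right (n := n) k l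
  rw [twistedConv_assoc hF (integrable_ofReal_laguerreFun hn k hl) (by fun_prop)
    (norm_laguerreFun_le hn k hl)]
  have : twistedConv l (fun w => (laguerreFun n k l w : ℂ)) (fun w => (laguerreFun n k l w : ℂ)) =
      fun z => twistConst n l * (laguerreFun n k l z : ℂ) :=
    funext fun z => twistedConv_laguerreFun_self hn hl k z
  rw [this]
  unfold twistedConv
  rw [← integral_const_mul]
  congr 1
  funext w
  ring

/-- Twisted convolution with `φ_{k,λ}` is a multiple of an orthogonal projection. -/
theorem integral_normSq_twistedConv_laguerreFun (hn : 1 ≤ n) {l : ℝ} (hl : l ≠ 0) {F : Cn n → ℂ}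
    (hF : Integrable F) (k : ℕ) :
    ∫ w, (‖twistedConv l F (fun w => (laguerreFun n k l w : ℂ)) w‖ ^ 2 : ℂ) =
      twistConst n l * ∫ y, starRingEnd ℂ (F y) *
        twistedConv l F (fun w => (laguerreFun n k l w : ℂ)) y := by
  have hc := continuous_laguerreFun_right (n := n) k l
  set T := twistedConv l F (fun w => (laguerreFun n k l w : ℂ)) with hT
  have hTi : Integrable T := integrable_twistedConv hF (integrable_ofReal_laguerreFun hn k hl)
  have hint : Integrable (fun p : Cn n × Cn n => T p.1 * starRingEnd ℂ (F p.2) *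
      ((laguerreFun n k l (p.2 - p.1) : ℂ) * twist l p.1 p.2)) (volume.prod volume) := by
    have h1 : Integrable (fun p : Cn n × Cn n => T p.1 * starRingEnd ℂ (F p.2))
        (volume.prod volume) :=
      hTi.mul_prod (Complex.conjCLE.toContinuousLinearMap.integrable_comp hF)
    refine (h1.norm.mul_const ((k + (n - 1)).choose k : ℝ)).mono'
      (h1.aestronglyMeasurable.mul (by fun_prop : Continuous _).aestronglyMeasurable)
      (Filter.Eventually.of_forall fun p => ?_)
    rw [norm_mul, norm_mul _ (twist _ _ _), norm_twist, mul_one]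
    gcongr
    exact norm_laguerreFun_le hn k hl _
  -- Conjugating the kernel `φ_k(w - y) twist(y, w)` exchanges `w` and `y`: the operator is
  -- self-adjoint, and its square is a multiple of itself.
  calc _ = ∫ w, ∫ y, T w * starRingEnd ℂ (F y) *
        ((laguerreFun n k l (y - w) : ℂ) * twist l w y) := by
        congr 1
        funext w
        rw [← Complex.mul_conj', hT, twistedConv, ← integral_conj, ← integral_const_mul]
        congr 1
        funext y
        rw [map_mul, map_mul, conj_twist, Complex.conj_ofReal, ← neg_sub y w, laguerreFun_neg_right]
        ring
    _ = ∫ y, ∫ w, T w * starRingEnd ℂ (F y) *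
        ((laguerreFun n k l (y - w) : ℂ) * twist l w y) := integral_integral_swap hint
    _ = ∫ y, starRingEnd ℂ (F y) * twistedConv l T (fun w => (laguerreFun n k l w : ℂ)) y := by
        congr 1
        funext y
        rw [twistedConv, ← integral_const_mul]
        congr 1
        funext w
        ring
    _ = _ := by
        rw [← integral_const_mul]
        congr 1
        funext y
        rw [twistedConv_twistedConv_laguerreFun hn hl hF]
        ring

end

/-! ### Abel summation and the Plancherel formula for Laguerre expansions. -/

section

open Filter Topology

variable {n : ℕ}

/-- As `r → 1`, the functions `mehler n l r` form a multiple of an approximate identity. -/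
theorem tendsto_integral_mehler_mul {l : ℝ} (hl : l ≠ 0) {H : Cn n → ℂ} (hH : Integrable H)
    (hc : ContinuousAt H 0) :
    Tendsto (fun r : ℝ => ∫ u, H u * mehler n l r u) (𝓝[<] 1) (𝓝 (twistConst n l * H 0)) := by
  have hl' : 0 < |l| := abs_pos.2 hl
  have hpi := Real.pi_pos
  have h := Real.tendsto_integral_gaussian_smul' hH hc
  have e : ((Module.finrank ℝ (Cn n) : ℕ) : ℂ) / 2 = (n : ℕ) := by
    rw [finrank_Cn]
    push_cast
    ring
  simp_rw [e, Complex.cpow_natCast] at h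
  have hinv : Tendsto (fun r : ℝ => (1 - r)⁻¹) (𝓝[<] 1) atTop := by
    refine tendsto_inv_nhdsGT_zero.comp ?_
    refine tendsto_nhdsWithin_of_tendsto_nhds_of_eventually_within _ ?_ ?_
    · have : Tendsto (fun r : ℝ => 1 - r) (𝓝 1) (𝓝 (1 - 1)) := by
        exact (continuous_const.sub continuous_id).tendsto 1
      rw [sub_self] at this
      exact this.mono_left nhdsWithin_le_nhds
    · filter_upwards [self_mem_nhdsWithin] with r hr
      exact sub_pos.2 (Set.mem_Iio.1 hr)
  -- The standard kernel is `(πc)^n exp(-π² c ‖u‖²)`; this is the value of `c` that matches the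
  -- exponent of `mehler`.
  have hcr : Tendsto (fun r : ℝ => |l| / (4 * Real.pi ^ 2) * ((1 + r) * (1 - r)⁻¹)) (𝓝[<] 1)
      atTop := by
    refine Tendsto.const_mul_atTop (by positivity) ?_
    refine Tendsto.pos_mul_atTop (C := 2) two_pos ?_ hinv
    have : Tendsto (fun r : ℝ => 1 + r) (𝓝 1) (𝓝 (1 + 1)) :=
      (continuous_const.add continuous_id).tendsto 1
    rw [one_add_one_eq_two] at this
    exact this.mono_left nhdsWithin_le_nhds
  -- The quotient of the two prefactors, `(1 - r)^{-n}` over `(πc)^n`.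
  have hpre : Tendsto (fun r : ℝ => (((4 * Real.pi / (|l| * (1 + r))) ^ n : ℝ) : ℂ)) (𝓝[<] 1)
      (𝓝 (twistConst n l)) := by
    have : Tendsto (fun r : ℝ => (((4 * Real.pi / (|l| * (1 + r))) ^ n : ℝ) : ℂ)) (𝓝 1)
        (𝓝 (((4 * Real.pi / (|l| * (1 + 1))) ^ n : ℝ) : ℂ)) := by
      refine (Complex.continuous_ofReal.tendsto _).comp ?_
      refine (Tendsto.div tendsto_const_nhds ?_ (by positivity)).pow n
      exact (continuous_const.mul (continuous_const.add continuous_id)).tendsto 1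
    have e2 : (4 * Real.pi / (|l| * (1 + 1))) ^ n = twistConst n l := by
      unfold twistConst
      congr 1
      field_simp
      norm_num
    rw [e2] at this
    exact this.mono_left nhdsWithin_le_nhds
  refine (hpre.mul (h.comp hcr)).congr' ?_
  filter_upwards [Ioo_mem_nhdsLT (show (0 : ℝ) < 1 by norm_num)] with r hr
  have h1r : 0 < 1 - r := by linarith [hr.2]
  have h1r' : 0 < 1 + r := by linarith [hr.1]
  simp only [Function.comp_apply]
  rw [← integral_const_mul]
  congr 1
  funext u
  rw [zero_sub, norm_neg, smul_eq_mul, mehler, ← mul_assoc, ← mul_assoc, mul_comm (H u)]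
  congr 1
  rw [← Complex.ofReal_mul, ← Complex.ofReal_pow, ← Complex.ofReal_mul]
  have e3 : (-(Real.pi : ℂ) ^ 2 * ((|l| / (4 * Real.pi ^ 2) * ((1 + r) * (1 - r)⁻¹) : ℝ) : ℂ) *
      (‖u‖ : ℂ) ^ 2) = ((-(1 / 4 * |l| * ((1 + r) / (1 - r))) * ‖u‖ ^ 2 : ℝ) : ℂ) := by
    have h1 : (1 - r : ℂ) ≠ 0 := by exact_mod_cast h1r.ne'
    push_cast
    field_simp
  rw [e3, ← Complex.ofReal_exp, ← Complex.ofReal_mul]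
  congr 1
  rw [← mul_pow, div_eq_mul_inv _ ((1 - r) ^ n), ← inv_pow, mul_comm (Real.exp _)]
  congr 2
  field_simp

theorem twistedConv_eq_integral_sub (l : ℝ) (F Φ : Cn n → ℂ) (y : Cn n) :
    twistedConv l F Φ y = ∫ u, F (y - u) * twist l y u * Φ u := by
  unfold twistedConv
  rw [← integral_sub_left_eq_self _ volume y]
  congr 1
  funext u
  have e : twist l (y - u) y = twist l y u := by
    unfold twist
    rw [symp_sub_left, symp_self, symp_swap y u]
    congr 3
    ring
  rw [sub_sub_cancel, e]
  ring

theorem tendsto_twistedConv_mehler {l : ℝ} (hl : l ≠ 0) {F : Cn n → ℂ} (hF : Integrable F)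
    {z : Cn n} (hc : ContinuousAt F z) :
    Tendsto (fun r : ℝ => twistedConv l F (fun w => (mehler n l r w : ℂ)) z) (𝓝[<] 1)
      (𝓝 (twistConst n l * F z)) := by
  simp_rw [twistedConv_eq_integral_sub]
  have hH : Integrable (fun u => F (z - u) * twist l z u) := by
    refine (hF.comp_sub_left z).norm.mono' ((hF.comp_sub_left z).aestronglyMeasurable.mul
      (by fun_prop : Continuous _).aestronglyMeasurable) (Eventually.of_forall fun u => ?_)
    rw [norm_mul, norm_twist, mul_one]
  have hcont : ContinuousAt (fun u => F (z - u) * twist l z u) 0 := by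
    refine ContinuousAt.mul ?_ (by fun_prop : Continuous _).continuousAt
    refine ContinuousAt.comp (g := F) (f := fun u => z - u) ?_ (by fun_prop)
    simpa using hc
  have h := tendsto_integral_mehler_mul hl hH hcont
  simpa [twist, symp_eq_inner] using h

theorem tendsto_eLpNorm_sub_translate {F : Cn n → ℂ} (hF : MemLp F 2) :
    Tendsto (fun u : Cn n => eLpNorm (fun y => F (y - u) - F y) 2 volume) (𝓝 0) (𝓝 0) := by
  let g : C(Cn n, C(Cn n, Cn n)) := ContinuousMap.curry ⟨fun p => p.2 - p.1, by fun_prop⟩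
  have hg : ∀ u, MeasurePreserving (g u) (volume : Measure (Cn n)) volume :=
    fun u => measurePreserving_sub_right volume u
  have h := (continuous_const (y := hF.toLp F)).compMeasurePreservingLp g.continuous hg
    (by norm_num : (2 : ENNReal) ≠ ⊤)
  have h2 := (h.tendsto 0).edist (tendsto_const_nhds (x := hF.toLp F))
  have e : ∀ u, edist (Lp.compMeasurePreserving (g u) (hg u) (hF.toLp F)) (hF.toLp F) =
      eLpNorm (fun y => F (y - u) - F y) 2 volume := by
    intro u
    rw [Lp.toLp_compMeasurePreserving, Lp.edist_toLp_toLp]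
    rfl
  simp_rw [e] at h2
  simpa using h2

/-- The twisted autocorrelation of a square integrable function is continuous at the origin. -/
theorem continuousAt_autocorrelation {F : Cn n → ℂ} (hF : MemLp F 2) (l : ℝ) :
    ContinuousAt (fun u => ∫ y, starRingEnd ℂ (F y) * (F (y - u) * twist l y u)) 0 := by
  have hFm := hF.aestronglyMeasurable
  have hFc : MemLp (fun y => starRingEnd ℂ (F y)) 2 volume := hF.star
  have hmp : ∀ u, MeasurePreserving (fun y : Cn n => y - u) volume volume :=
    fun u => measurePreserving_sub_right volume u
  have hFu : ∀ u, MemLp (fun y => F (y - u)) 2 volume := fun u => hF.comp_measurePreserving (hmp u)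
  have hsq : Integrable (fun y => ‖F y‖ ^ 2) := hF.integrable_norm_pow two_ne_zero
  -- Replacing `F (y - u)` by `F y` costs at most `‖F‖₂` times the `L²` modulus of continuity of
  -- translation; what is left, `hB`, is dominated by `‖F y‖²`.
  have hA : Tendsto (fun u => ∫ y, starRingEnd ℂ (F y) * ((F (y - u) - F y) * twist l y u))
      (𝓝 0) (𝓝 0) := by
    rw [tendsto_zero_iff_enorm_tendsto_zero]
    have h1 := ENNReal.Tendsto.const_mul (tendsto_eLpNorm_sub_translate hF)
      (a := eLpNorm F 2 volume) (Or.inr hF.2.ne)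
    rw [mul_zero] at h1
    refine tendsto_of_tendsto_of_tendsto_of_le_of_le tendsto_const_nhds h1 (fun _ => bot_le)
      (fun u => ?_)
    refine (enorm_integral_le_lintegral_enorm _).trans ?_
    rw [← eLpNorm_one_eq_lintegral_enorm]
    have h2 := eLpNorm_le_eLpNorm_mul_eLpNorm'_of_norm (p := 2) (q := 2) (r := 1)
      hFm ((hFu u).sub hF).aestronglyMeasurable (μ := volume)
      (fun a b => a * b) 1 (Eventually.of_forall fun y => by simp)
    rw [ENNReal.coe_one, one_mul] at h2
    refine le_trans (le_of_eq ?_) h2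
    refine eLpNorm_congr_norm_ae (Eventually.of_forall fun y => ?_)
    simp
  have hB : Tendsto (fun u => ∫ y, starRingEnd ℂ (F y) * (F y * twist l y u)) (𝓝 0)
      (𝓝 (∫ y, starRingEnd ℂ (F y) * (F y * twist l y 0))) := by
    refine tendsto_integral_filter_of_dominated_convergence (fun y => ‖F y‖ ^ 2)
      (Eventually.of_forall fun u => ?_) (Eventually.of_forall fun u => Eventually.of_forall
        fun y => ?_) hsq (Eventually.of_forall fun y => ?_)
    · exact hFc.aestronglyMeasurable.mul
        (hFm.mul (by fun_prop : Continuous _).aestronglyMeasurable)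
    · simp [sq]
    · exact (by fun_prop : Continuous fun u => starRingEnd ℂ (F y) * (F y * twist l y u)).tendsto 0
  have hsum := hA.add hB
  rw [zero_add] at hsum
  have e0 : ∫ y, starRingEnd ℂ (F y) * (F y * twist l y 0) =
      ∫ y, starRingEnd ℂ (F y) * (F (y - 0) * twist l y 0) := by simp
  rw [e0] at hsum
  refine Tendsto.congr (fun u => ?_) hsum
  have hbd : ∀ {K : Cn n → ℂ}, MemLp K 2 volume →
      Integrable (fun y => starRingEnd ℂ (F y) * (K y * twist l y u)) := by
    intro K hK
    have h1 : Integrable (fun y => starRingEnd ℂ (F y) * K y) := hFc.integrable_mul hK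
    refine h1.norm.mono' (hFc.aestronglyMeasurable.mul
      (hK.aestronglyMeasurable.mul (by fun_prop : Continuous _).aestronglyMeasurable))
      (Eventually.of_forall fun y => ?_)
    simp
  have hd : MemLp (fun y => F (y - u) - F y) 2 volume := (hFu u).sub hF
  rw [← integral_add (hbd hd) (hbd hF)]
  congr 1
  funext y
  ring

/-- By Fubini the pairing is the integral of the twisted autocorrelation of `F` against `mehler`.
The autocorrelation is continuous at `0` even when `F` is nowhere continuous. -/
theorem tendsto_integral_conj_mul_twistedConv_mehler {l : ℝ} (hl : l ≠ 0) {F : Cn n → ℂ}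
    (hF : Integrable F) (hF2 : MemLp F 2) :
    Tendsto (fun r : ℝ => ∫ y, starRingEnd ℂ (F y) *
      twistedConv l F (fun w => (mehler n l r w : ℂ)) y) (𝓝[<] 1)
      (𝓝 (twistConst n l * ∫ y, (‖F y‖ ^ 2 : ℂ))) := by
  have hFc : Integrable (fun y => starRingEnd ℂ (F y)) :=
    Complex.conjCLE.toContinuousLinearMap.integrable_comp hF
  have hk : Integrable (fun p : Cn n × Cn n =>
      starRingEnd ℂ (F p.1) * (F (p.1 - p.2) * twist l p.1 p.2)) (volume.prod volume) := by
    have h1 : Integrable (fun p : Cn n × Cn n => starRingEnd ℂ (F p.2) * F (p.2 - p.1))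
        (volume.prod volume) := by
      have h2 := integrable_conv_kernel hFc hF.comp_neg
      refine h2.congr (Eventually.of_forall fun p => ?_)
      simp
    refine h1.swap.norm.mono' (.congr (h1.swap.aestronglyMeasurable.mul
      (by fun_prop : Continuous fun p : Cn n × Cn n => twist l p.1 p.2).aestronglyMeasurable)
      (Eventually.of_forall fun p => ?_)) (Eventually.of_forall fun p => ?_)
    · simp [mul_assoc]
    · simp
  have hH := hk.integral_prod_right
  have h := tendsto_integral_mehler_mul hl hH (continuousAt_autocorrelation hF2 l)
  have e0 : ∫ y, starRingEnd ℂ (F y) * (F (y - 0) * twist l y 0) = ∫ y, (‖F y‖ ^ 2 : ℂ) := by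
    congr 1
    funext y
    simp [twist, symp_eq_inner, Complex.conj_mul']
  rw [e0] at h
  refine h.congr' ?_
  filter_upwards [Ioo_mem_nhdsLT (show (0 : ℝ) < 1 by norm_num)] with r hr
  have hM : Continuous (mehler n l r) := continuous_mehler l r
  simp_rw [twistedConv_eq_integral_sub, ← integral_const_mul, ← integral_mul_const]
  rw [integral_integral_swap]
  · congr 1; funext y; congr 1; funext u; ring
  · have h1 : Integrable (fun p : Cn n × Cn n =>
        (starRingEnd ℂ (F p.1) * (F (p.1 - p.2) * twist l p.1 p.2)) * (mehler n l r p.2 : ℂ))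
        (volume.prod volume) := by
      refine (hk.norm.mul_const (1 / (1 - r) ^ n)).mono' (hk.aestronglyMeasurable.mul
        (by fun_prop : Continuous _).aestronglyMeasurable) (Eventually.of_forall fun p => ?_)
      rw [norm_mul _ ((mehler n l r p.2 : ℝ) : ℂ)]
      gcongr
      have h1r : 0 < 1 - r := by linarith [hr.2]
      have h1r' : 0 < 1 + r := by linarith [hr.1]
      rw [Complex.norm_real, mehler, norm_div, Real.norm_eq_abs, Real.abs_exp, norm_pow,
        Real.norm_of_nonneg h1r.le]
      gcongr
      rw [Real.exp_le_one_iff, neg_mul]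
      have : 0 < (1 + r) / (1 - r) := by positivity
      exact neg_nonpos.2 (by positivity)
    exact h1.swap

/-- A nonnegative Abel summable series is summable. -/
theorem hasSum_of_tendsto_abel {a : ℕ → ℝ} (ha : ∀ k, 0 ≤ a k) {S : ℝ → ℝ} {L : ℝ}
    (hS : ∀ r, 0 < r → r < 1 → HasSum (fun k => a k * r ^ k) (S r))
    (hL : Tendsto S (𝓝[<] 1) (𝓝 L)) : HasSum a L := by
  -- By nonnegativity a partial sum of `a k * r ^ k` is at most `S r`; letting `r → 1` bounds the
  -- partial sums of `a`. Abel's limit theorem then identifies the sum.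
  have hpart : ∀ N, ∑ k ∈ Finset.range N, a k ≤ L := by
    intro N
    have h1 : Tendsto (fun r : ℝ => ∑ k ∈ Finset.range N, a k * r ^ k) (𝓝[<] 1)
        (𝓝 (∑ k ∈ Finset.range N, a k)) := by
      have : Tendsto (fun r : ℝ => ∑ k ∈ Finset.range N, a k * r ^ k) (𝓝 1)
          (𝓝 (∑ k ∈ Finset.range N, a k * 1 ^ k)) :=
        (by fun_prop : Continuous fun r : ℝ => ∑ k ∈ Finset.range N, a k * r ^ k).tendsto 1
      simp only [one_pow, mul_one] at this
      exact this.mono_left nhdsWithin_le_nhds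
    refine le_of_tendsto_of_tendsto h1 hL ?_
    filter_upwards [Ioo_mem_nhdsLT (show (0 : ℝ) < 1 by norm_num)] with r hr
    have hr0 := hr.1
    exact sum_le_hasSum _ (fun k _ => mul_nonneg (ha k) (by positivity)) (hS r hr.1 hr.2)
  have hsum : Summable a := summable_of_sum_range_le ha hpart
  have habel := Real.tendsto_tsum_powerSeries_nhdsWithin_lt hsum.hasSum.tendsto_sum_nat
  have h2 : Tendsto S (𝓝[<] 1) (𝓝 (∑' k, a k)) := by
    refine habel.congr' ?_
    filter_upwards [Ioo_mem_nhdsLT (show (0 : ℝ) < 1 by norm_num)] with r hr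
    exact (hS r hr.1 hr.2).tsum_eq
  rw [tendsto_nhds_unique hL h2]
  exact hsum.hasSum

/-- The Plancherel formula for the expansion into twisted convolutions with Laguerre functions. -/
theorem hasSum_integral_normSq_twistedConv (hn : 1 ≤ n) {l : ℝ} (hl : l ≠ 0) {F : Cn n → ℂ}
    (hF : Integrable F) (hF2 : MemLp F 2) :
    HasSum (fun k => ∫ w, ‖twistedConv l F (fun w => (laguerreFun n k l w : ℂ)) w‖ ^ 2)
      (twistConst n l ^ 2 * ∫ y, ‖F y‖ ^ 2) := by
  have hFc : Integrable (fun y => starRingEnd ℂ (F y)) :=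
    Complex.conjCLE.toContinuousLinearMap.integrable_comp hF
  -- The projection identity turns `∑ r^k ‖F × φ_k‖²` into one pairing with the generating function.
  -- Its limit contributes the second factor `twistConst`.
  have key : ∀ r : ℝ, |r| < 1 → HasSum (fun k =>
      ((∫ w, ‖twistedConv l F (fun w => (laguerreFun n k l w : ℂ)) w‖ ^ 2 : ℝ) : ℂ) * (r : ℂ) ^ k)
      (twistConst n l * ∫ y, starRingEnd ℂ (F y) *
        twistedConv l F (fun w => (mehler n l r w : ℂ)) y) := by
    intro r hr
    have hg := hasSum_choose_mul_geometric_of_norm_lt_one (𝕜 := ℝ) (n - 1) (r := |r|)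
      (by simpa using hr)
    have h1 : HasSum (fun k => ∫ y, starRingEnd ℂ (F y) *
        (twistedConv l F (fun w => (laguerreFun n k l w : ℂ)) y * (r : ℂ) ^ k))
        (∫ y, starRingEnd ℂ (F y) * twistedConv l F (fun w => (mehler n l r w : ℂ)) y) := by
      refine hasSum_integral_of_dominated_convergence (fun k y => ‖F y‖ *
        (((k + (n - 1)).choose (n - 1) : ℝ) * |r| ^ k * ∫ w, ‖F w‖)) ?_ ?_ ?_ ?_ ?_
      · intro k
        exact hFc.aestronglyMeasurable.mul ((integrable_twistedConv hF
          (integrable_ofReal_laguerreFun hn k hl)).aestronglyMeasurable.mul_const _)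
      · refine fun k => Eventually.of_forall fun y => ?_
        rw [norm_mul, norm_mul, RCLike.norm_conj, norm_pow, Complex.norm_real, Real.norm_eq_abs,
          mul_right_comm ((_ : ℕ) : ℝ)]
        gcongr
        rw [← Nat.choose_symm_add]
        exact norm_twistedConv_le hF (norm_laguerreFun_le hn k hl) y
      · exact Eventually.of_forall fun y => (hg.summable.mul_right _).mul_left _
      · simp_rw [tsum_mul_left]
        exact hF.norm.mul_const _
      · exact Eventually.of_forall fun y =>
          (hasSum_twistedConv_laguerreFun_of_integrable hn hl hF hr y).mul_left _
    refine HasSum.of_eq (h1.mul_left (twistConst n l : ℂ)) (fun k => ?_) rfl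
    have h3 := integral_normSq_twistedConv_laguerreFun hn hl hF k
    rw [← integral_complex_ofReal]
    push_cast
    rw [h3]
    simp_rw [← mul_assoc]
    rw [integral_mul_const]
    ring
  refine hasSum_of_tendsto_abel (S := fun r => (twistConst n l * ∫ y, starRingEnd ℂ (F y) *
        twistedConv l F (fun w => (mehler n l r w : ℂ)) y).re)
    (fun k => integral_nonneg fun w => by positivity) (fun r h0 h1 => ?_) ?_
  · have h := Complex.hasSum_re (key r (abs_lt.2 ⟨by linarith, h1⟩))
    refine HasSum.of_eq h (fun k => ?_) rfl
    rw [← Complex.ofReal_pow, ← Complex.ofReal_mul, Complex.ofReal_re]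
  · have h := (tendsto_integral_conj_mul_twistedConv_mehler hl hF hF2).const_mul
      (twistConst n l : ℂ)
    have h2 := (Complex.continuous_re.tendsto _).comp h
    refine h2.congr (fun r => rfl) |>.trans (le_of_eq ?_)
    congr 1
    have : ∫ y, (‖F y‖ ^ 2 : ℂ) = ((∫ y, ‖F y‖ ^ 2 : ℝ) : ℂ) := by
      rw [← integral_complex_ofReal]
      push_cast
      rfl
    rw [this, ← Complex.ofReal_mul, ← Complex.ofReal_mul, Complex.ofReal_re]
    ring

end

/-! ### Temperate growth, left invariant vector fields and Green's formula. -/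

section

open Filter Topology
open scoped ContDiff LineDeriv

variable {n : ℕ}

section TemperateGrowth

variable {E G : Type*} [NormedAddCommGroup E] [NormedSpace ℝ E] [NormedAddCommGroup G]
  [NormedSpace ℝ G]

theorem hasTemperateGrowth_fderiv {f : E → G} (hf : f.HasTemperateGrowth) :
    (fderiv ℝ f).HasTemperateGrowth := by
  refine ⟨hf.1.fderiv_right (by simp), fun N => ?_⟩
  obtain ⟨k, C, h⟩ := hf.2 (N + 1)
  exact ⟨k, C, fun x => by rw [norm_iteratedFDeriv_fderiv]; exact h x⟩

/-- The exponential of a function of temperate growth with nonpositive real part has temperate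
growth. -/
theorem hasTemperateGrowth_cexp {q : E → ℂ} (hq : q.HasTemperateGrowth) (hre : ∀ x, (q x).re ≤ 0) :
    (fun x => Complex.exp (q x)).HasTemperateGrowth := by
  have hexp : ContDiff ℝ ∞ (fun x => Complex.exp (q x)) := hq.1.cexp
  have hq' := hasTemperateGrowth_fderiv hq
  have hfd : fderiv ℝ (fun x => Complex.exp (q x)) = fun x => Complex.exp (q x) • fderiv ℝ q x := by
    funext x
    exact ((hq.1.differentiable (by simp) x).hasFDerivAt.cexp).fderiv
  refine ⟨hexp, fun N => ?_⟩
  -- Since `D(e^q) = e^q Dq`, the Leibniz rule bounds the derivative of order `N + 1` by derivatives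
  -- of `e^q` of order at most `N`.
  induction N using Nat.strong_induction_on with
  | _ N ih =>
    rcases N with _ | N
    · refine ⟨0, 1, fun x => ?_⟩
      simp [Complex.norm_exp, hre x]
    · choose! k C h using ih
      obtain ⟨k', C', hC', h'⟩ := hq'.norm_iteratedFDeriv_le_uniform N
      refine ⟨(∑ i ∈ Finset.range (N + 1), k i) + k',
        ∑ i ∈ Finset.range (N + 1), (N.choose i : ℝ) * |C i| * C', fun x => ?_⟩
      have h1 := norm_iteratedFDeriv_smul_le (𝕜 := ℝ) hexp hq'.1 x (n := N) (by exact_mod_cast le_top)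
      rw [← norm_iteratedFDeriv_fderiv, hfd]
      refine h1.trans ?_
      rw [Finset.sum_mul]
      refine Finset.sum_le_sum fun i hi => ?_
      have hi' : i < N + 1 := Finset.mem_range.1 hi
      have hx : 1 ≤ 1 + ‖x‖ := by linarith [norm_nonneg x]
      have h2 : ‖iteratedFDeriv ℝ i (fun x => Complex.exp (q x)) x‖ ≤
          |C i| * (1 + ‖x‖) ^ (∑ i ∈ Finset.range (N + 1), k i) := by
        refine (h i hi' x).trans ?_
        gcongr
        · exact le_abs_self _
        · exact Finset.single_le_sum (fun _ _ => Nat.zero_le _) hi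
      have h3 := h' (N - i) (Nat.sub_le _ _) x
      calc _ ≤ (N.choose i : ℝ) * (|C i| * (1 + ‖x‖) ^ (∑ i ∈ Finset.range (N + 1), k i)) *
            (C' * (1 + ‖x‖) ^ k') := by gcongr
        _ = _ := by rw [pow_add]; ring

theorem hasTemperateGrowth_eval {f : E → ℝ} (hf : f.HasTemperateGrowth) (P : Polynomial ℝ) :
    (fun x => P.eval (f x)).HasTemperateGrowth := by
  simp only [Polynomial.eval_eq_sum_range]
  exact .sum fun i _ => (Function.HasTemperateGrowth.const _).mul (hf.pow i)

end TemperateGrowth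

instance : (volume : Measure (Heis n)).IsAddHaarMeasure :=
  inferInstanceAs ((volume : Measure (Cn n)).prod (volume : Measure ℝ)).IsAddHaarMeasure

/-- The value at `p` of the left invariant vector field `X_v` on `ℍⁿ` generated by `v ∈ ℂⁿ`. -/
def horizontal (v : Cn n) (p : Heis n) : Heis n := (v, 1 / 2 * symp p.1 v)

theorem hasTemperateGrowth_symp_left (v : Cn n) :
    (fun p : Heis n => symp p.1 v).HasTemperateGrowth := by
  simp only [symp_eq_inner]
  exact (Function.hasTemperateGrowth_inner_right _).comp
    (ContinuousLinearMap.fst ℝ (Cn n) ℝ).hasTemperateGrowth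

/-- The left invariant vector field `X_v` acting on Schwartz functions. -/
def horizontalDeriv (v : Cn n) (f : 𝓢(Heis n, ℂ)) : 𝓢(Heis n, ℂ) :=
  ∂_{((v, 0) : Heis n)} f +
    SchwartzMap.smulLeftCLM ℂ (fun p : Heis n => 1 / 2 * symp p.1 v) (∂_{((0, 1) : Heis n)} f)

theorem horizontalDeriv_apply (v : Cn n) (f : 𝓢(Heis n, ℂ)) (p : Heis n) :
    horizontalDeriv v f p = fderiv ℝ f p (horizontal v p) := by
  have ht : (fun p : Heis n => 1 / 2 * symp p.1 v).HasTemperateGrowth :=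
    (Function.HasTemperateGrowth.const _).mul (hasTemperateGrowth_symp_left v)
  have e : horizontal v p = (v, 0) + (1 / 2 * symp p.1 v) • ((0, 1) : Heis n) := by
    ext <;> simp [horizontal]
  rw [horizontalDeriv, add_apply, SchwartzMap.smulLeftCLM_apply_apply ht,
    SchwartzMap.lineDerivOp_apply_eq_fderiv, SchwartzMap.lineDerivOp_apply_eq_fderiv, e, map_add,
    map_smul]

/-- The field `X_v` is divergence free: its central coefficient depends on `p.1` alone, so it is
constant in the central direction in which it differentiates. -/
theorem integral_horizontalDeriv (v : Cn n) (f : 𝓢(Heis n, ℂ)) :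
    ∫ p, horizontalDeriv v f p = 0 := by
  have ht : (fun p : Heis n => 1 / 2 * symp p.1 v).HasTemperateGrowth :=
    (Function.HasTemperateGrowth.const _).mul (hasTemperateGrowth_symp_left v)
  have key : ∀ (c : Heis n → ℝ) (d : Heis n), c.HasTemperateGrowth → (∀ p, fderiv ℝ c p d = 0) →
      ∫ p, c p • fderiv ℝ f p d = 0 := by
    intro c d hc hcd
    rw [integral_smul_fderiv_eq_neg_fderiv_smul_of_integrable]
    · simp [hcd]
    · simp [hcd]
    · refine (SchwartzMap.smulLeftCLM ℂ c (∂_{d} f)).integrable.congr (Eventually.of_forall fun p => ?_)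
      rw [SchwartzMap.smulLeftCLM_apply_apply hc, SchwartzMap.lineDerivOp_apply_eq_fderiv]
    · refine (SchwartzMap.smulLeftCLM ℂ c f).integrable.congr (Eventually.of_forall fun p => ?_)
      rw [SchwartzMap.smulLeftCLM_apply_apply hc]
    · exact fun p _ => hc.1.differentiable (by simp) p
    · exact fun p _ => f.differentiableAt
  have h1 := key (fun _ => 1) (v, 0) (.const _) (by simp)
  have h2 := key (fun p => 1 / 2 * symp p.1 v) (0, 1) ht (fun p => by
    have hd := (ht.1.differentiable (by simp) p).lineDeriv_eq_fderiv (v := ((0, 1) : Heis n))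
    rw [← hd]
    simp [lineDeriv])
  unfold horizontalDeriv
  simp only [one_smul] at h1
  have e1 : ∀ p, (∂_{((v, 0) : Heis n)} f) p = fderiv ℝ f p (v, 0) := fun p =>
    SchwartzMap.lineDerivOp_apply_eq_fderiv _ _ _
  have e2 : ∀ p, (SchwartzMap.smulLeftCLM ℂ (fun p : Heis n => 1 / 2 * symp p.1 v)
      (∂_{((0, 1) : Heis n)} f)) p = (1 / 2 * symp p.1 v) • fderiv ℝ f p (0, 1) := fun p => by
    rw [SchwartzMap.smulLeftCLM_apply_apply ht, SchwartzMap.lineDerivOp_apply_eq_fderiv]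
  calc _ = ∫ p, ((∂_{((v, 0) : Heis n)} f) p + (SchwartzMap.smulLeftCLM ℂ
        (fun p : Heis n => 1 / 2 * symp p.1 v) (∂_{((0, 1) : Heis n)} f)) p) := rfl
    _ = _ := by
      rw [integral_add (SchwartzMap.integrable _) (SchwartzMap.integrable _)]
      simp_rw [e1, e2]
      rw [h1, h2, add_zero]

/-- Green's formula for `X_v²`. -/
theorem integral_horizontalDeriv_horizontalDeriv_mul (v : Cn n) (f : 𝓢(Heis n, ℂ))
    {K K₁ K₂ : Heis n → ℂ} (hK : K.HasTemperateGrowth) (hK₁ : K₁.HasTemperateGrowth)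
    (h₁ : ∀ p, fderiv ℝ K p (horizontal v p) = K₁ p)
    (h₂ : ∀ p, fderiv ℝ K₁ p (horizontal v p) = K₂ p) :
    ∫ p, horizontalDeriv v (horizontalDeriv v f) p * K p = ∫ p, f p * K₂ p := by
  -- Green's identity in divergence form: `X(K · Xf - XK · f) = K · X²f - f · X²K`, and the left
  -- side has integral zero.
  have e : ∀ p, horizontalDeriv v (SchwartzMap.smulLeftCLM ℂ K (horizontalDeriv v f) -
      SchwartzMap.smulLeftCLM ℂ K₁ f) p =
      horizontalDeriv v (horizontalDeriv v f) p * K p - f p * K₂ p := by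
    intro p
    have c : (⇑(SchwartzMap.smulLeftCLM ℂ K (horizontalDeriv v f) -
        SchwartzMap.smulLeftCLM ℂ K₁ f) : Heis n → ℂ) =
        K * horizontalDeriv v f - K₁ * f := by
      funext q
      rw [sub_apply, SchwartzMap.smulLeftCLM_apply_apply hK,
        SchwartzMap.smulLeftCLM_apply_apply hK₁]
      rfl
    have dK := hK.1.differentiable (by simp) p
    have dK₁ := hK₁.1.differentiable (by simp) p
    have dX := (horizontalDeriv v f).differentiableAt (x := p)
    have df := f.differentiableAt (x := p)
    rw [horizontalDeriv_apply, c, fderiv_sub (dK.mul dX) (dK₁.mul df)]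
    rw [fderiv_mul dK dX, fderiv_mul dK₁ df]
    simp only [sub_apply, add_apply,
      smul_apply, smul_eq_mul]
    rw [← horizontalDeriv_apply, ← horizontalDeriv_apply, h₁, h₂]
    ring
  have hz := integral_horizontalDeriv v (SchwartzMap.smulLeftCLM ℂ K (horizontalDeriv v f) -
      SchwartzMap.smulLeftCLM ℂ K₁ f)
  have hint : Integrable fun p => horizontalDeriv v (horizontalDeriv v f) p * K p := by
    refine (SchwartzMap.smulLeftCLM ℂ K (horizontalDeriv v (horizontalDeriv v f))).integrable.congr
      (Eventually.of_forall fun p => ?_)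
    rw [SchwartzMap.smulLeftCLM_apply_apply hK, smul_eq_mul, mul_comm]
  -- No growth of `K₂` is assumed; integrability follows because `f K₂` is a difference of
  -- integrable functions.
  have hint2 : Integrable fun p => f p * K₂ p := by
    refine (hint.sub (SchwartzMap.integrable (horizontalDeriv v
      (SchwartzMap.smulLeftCLM ℂ K (horizontalDeriv v f) -
      SchwartzMap.smulLeftCLM ℂ K₁ f)))).congr (Eventually.of_forall fun p => ?_)
    simp only [Pi.sub_apply, e]
    ring
  simp_rw [e] at hz
  rw [integral_sub hint hint2] at hz
  exact sub_eq_zero.1 hz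

end

/-! ### The eigenfunctions `e_{k,λ}` of the sublaplacian. -/

section

open Filter Topology
open scoped ContDiff

variable {n : ℕ}

/-- The radial profile `ρ ↦ P(|λ|ρ/2) e^{-|λ|ρ/4}`. -/
def radial (l : ℝ) (P : Polynomial ℝ) (ρ : ℝ) : ℝ :=
  P.eval (1 / 2 * |l| * ρ) * Real.exp (-(1 / 4 * |l| * ρ))

/-- The derivative of `radial l P` is `radial l (radialD l P)`. -/
def radialD (l : ℝ) (P : Polynomial ℝ) : Polynomial ℝ :=
  Polynomial.C (1 / 2 * |l|) * (P.derivative - Polynomial.C (1 / 2) * P)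

theorem hasDerivAt_radial (l : ℝ) (P : Polynomial ℝ) (ρ : ℝ) :
    HasDerivAt (radial l P) (radial l (radialD l P) ρ) ρ := by
  have h1 : HasDerivAt (fun ρ : ℝ => 1 / 2 * |l| * ρ) (1 / 2 * |l|) ρ := by
    simpa using (hasDerivAt_id ρ).const_mul (1 / 2 * |l|)
  have h2 : HasDerivAt (fun ρ : ℝ => -(1 / 4 * |l| * ρ)) (-(1 / 4 * |l|)) ρ := by
    simpa using ((hasDerivAt_id ρ).const_mul (1 / 4 * |l|)).fun_neg
  have h := ((P.hasDerivAt _).comp ρ h1).mul h2.exp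
  refine h.congr_deriv ?_
  simp only [radial, radialD, Polynomial.eval_mul, Polynomial.eval_C, Polynomial.eval_sub,
    Function.comp_apply]
  ring

theorem laguerreFun_eq_radial (k : ℕ) (l : ℝ) (z : Cn n) :
    laguerreFun n k l z = radial l (laguerrePoly (n - 1) k) (‖z‖ ^ 2) := by
  rw [laguerreFun, radial, eval_laguerrePoly]

/-- Laguerre's equation in `ρ = ‖z‖²`: on `ℝ²ⁿ` the Laplacian of `g(‖z‖²)` is `4ρg'' + 4ng'`, and
`-λ²ρ/4` comes from the phase. -/
theorem radial_laguerrePoly_ode (hn : 1 ≤ n) (k : ℕ) (l ρ : ℝ) :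
    4 * ρ * radial l (radialD l (radialD l (laguerrePoly (n - 1) k))) ρ +
      4 * n * radial l (radialD l (laguerrePoly (n - 1) k)) ρ -
      l ^ 2 / 4 * ρ * radial l (laguerrePoly (n - 1) k) ρ =
      -((2 * k + n) * |l|) * radial l (laguerrePoly (n - 1) k) ρ := by
  have h := congrArg (Polynomial.eval (1 / 2 * |l| * ρ)) (laguerrePoly_ode (n - 1) k)
  simp only [Polynomial.eval_add, Polynomial.eval_mul, Polynomial.eval_X, Polynomial.eval_sub,
    Polynomial.eval_C, Polynomial.eval_zero] at h
  have hn' : ((n - 1 : ℕ) : ℝ) = n - 1 := by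
    rw [Nat.cast_sub hn, Nat.cast_one]
  rw [hn'] at h
  simp only [radial, radialD, Polynomial.eval_mul, Polynomial.eval_C, Polynomial.eval_sub,
    Polynomial.derivative_mul, Polynomial.derivative_C, Polynomial.derivative_sub, zero_mul,
    zero_add]
  rw [← sq_abs l]
  linear_combination 2 * |l| * Real.exp (-(1 / 4 * |l| * ρ)) * h

/-- The character part `e^{iλτ}` of `e_{k,λ}` at `(w, s)⁻¹ (z, 0)`. -/
def kernelPhase (l : ℝ) (z : Cn n) (p : Heis n) : ℂ :=
  Complex.exp ((l * (-p.2 - 1 / 2 * symp p.1 z) : ℝ) * Complex.I)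

theorem hasTemperateGrowth_ofReal {f : Heis n → ℝ} (hf : f.HasTemperateGrowth) :
    (fun p => (f p : ℂ)).HasTemperateGrowth :=
  Complex.ofRealCLM.hasTemperateGrowth.comp hf

theorem hasTemperateGrowth_kernelPhase (l : ℝ) (z : Cn n) :
    (kernelPhase l z).HasTemperateGrowth := by
  have h1 : (fun p : Heis n => l * (-p.2 - 1 / 2 * symp p.1 z)).HasTemperateGrowth :=
    (Function.HasTemperateGrowth.const _).mul
      ((ContinuousLinearMap.snd ℝ (Cn n) ℝ).hasTemperateGrowth.neg.sub
        ((Function.HasTemperateGrowth.const _).mul (hasTemperateGrowth_symp_left z)))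
  exact hasTemperateGrowth_cexp ((hasTemperateGrowth_ofReal h1).mul (.const _)) (fun p => by simp)

theorem hasTemperateGrowth_sub_fst (z : Cn n) :
    (fun p : Heis n => z - p.1).HasTemperateGrowth :=
  (Function.HasTemperateGrowth.const _).sub (ContinuousLinearMap.fst ℝ (Cn n) ℝ).hasTemperateGrowth

theorem hasTemperateGrowth_radial (l : ℝ) (P : Polynomial ℝ) (z : Cn n) :
    (fun p : Heis n => (radial l P (‖z - p.1‖ ^ 2) : ℂ)).HasTemperateGrowth := by
  have h1 : (fun p : Heis n => ‖z - p.1‖ ^ 2).HasTemperateGrowth :=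
    (Function.hasTemperateGrowth_norm_sq (Cn n)).comp (hasTemperateGrowth_sub_fst z)
  have h2 : (fun p : Heis n => 1 / 2 * |l| * ‖z - p.1‖ ^ 2).HasTemperateGrowth :=
    (Function.HasTemperateGrowth.const _).mul h1
  have h3 : (fun p : Heis n => -(1 / 4 * |l| * ‖z - p.1‖ ^ 2)).HasTemperateGrowth :=
    ((Function.HasTemperateGrowth.const _).mul h1).neg
  have h4 := hasTemperateGrowth_cexp (hasTemperateGrowth_ofReal h3) (fun p => by
    rw [Complex.ofReal_re]
    exact neg_nonpos.2 (by positivity))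
  have h5 := (hasTemperateGrowth_ofReal (hasTemperateGrowth_eval h2 P)).mul h4
  refine (congrArg Function.HasTemperateGrowth (funext fun p => ?_)).mp h5
  simp [radial]

/-- Along this direction the exponent is affine in `t`. The central and symplectic contributions
combine into a function of `z - p.1`, as left invariance predicts. -/
theorem hasDerivAt_kernelPhase (l : ℝ) (z v : Cn n) (p : Heis n) :
    HasDerivAt (fun t : ℝ => kernelPhase l z (p + t • horizontal v p))
      (kernelPhase l z p * (-(l / 2 * symp v (z - p.1)) * Complex.I)) 0 := by
  have e : ∀ t : ℝ, kernelPhase l z (p + t • horizontal v p) = kernelPhase l z p *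
      Complex.exp ((t : ℂ) * (-(l / 2 * symp v (z - p.1)) * Complex.I)) := by
    intro t
    unfold kernelPhase horizontal
    rw [← Complex.exp_add]
    congr 1
    simp only [Prod.fst_add, Prod.snd_add, Prod.smul_fst, Prod.smul_snd, symp_add_left,
      symp_smul_left, symp_sub_right, symp_swap p.1 v, smul_eq_mul]
    push_cast
    ring
  simp_rw [e]
  have h := (((hasDerivAt_id (0 : ℝ)).ofReal_comp.mul_const
    (-(l / 2 * symp v (z - p.1)) * Complex.I)).cexp).const_mul (kernelPhase l z p)
  simpa using h

theorem hasDerivAt_radial_line (l : ℝ) (P : Polynomial ℝ) (z v : Cn n) (p : Heis n) :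
    HasDerivAt (fun t : ℝ => (radial l P (‖z - (p + t • horizontal v p).1‖ ^ 2) : ℂ))
      (-2 * inner ℝ (z - p.1) v * radial l (radialD l P) (‖z - p.1‖ ^ 2) : ℝ) 0 := by
  have e : ∀ t : ℝ, ‖z - (p + t • horizontal v p).1‖ ^ 2 =
      ‖z - p.1‖ ^ 2 - 2 * inner ℝ (z - p.1) v * t + t ^ 2 * ‖v‖ ^ 2 := by
    intro t
    have : z - (p + t • horizontal v p).1 = (z - p.1) - t • v := by
      simp [horizontal]
      abel
    rw [this, norm_sub_sq_real, inner_smul_right, norm_smul, mul_pow, Real.norm_eq_abs, sq_abs]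
    ring
  simp_rw [e]
  refine HasDerivAt.ofReal_comp ?_
  have h1 : HasDerivAt (fun t : ℝ => ‖z - p.1‖ ^ 2 - 2 * inner ℝ (z - p.1) v * t + t ^ 2 * ‖v‖ ^ 2)
      (-2 * inner ℝ (z - p.1) v) 0 := by
    have a := ((hasDerivAt_id (0 : ℝ)).const_mul (2 * inner ℝ (z - p.1) v)).const_sub
      (‖z - p.1‖ ^ 2)
    have b := ((hasDerivAt_id (0 : ℝ)).pow 2).mul_const (‖v‖ ^ 2)
    refine (a.add b).congr_deriv ?_
    simp
  have h2 : HasDerivAt (radial l P) (radial l (radialD l P) (‖z - p.1‖ ^ 2))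
      (‖z - p.1‖ ^ 2 - 2 * inner ℝ (z - p.1) v * 0 + 0 ^ 2 * ‖v‖ ^ 2) := by
    have := hasDerivAt_radial l P (‖z - p.1‖ ^ 2)
    simpa using this
  refine (h2.comp 0 h1).congr_deriv ?_
  ring

/-- `e_{k,λ}((w, s)⁻¹ (z, 0))` with the Laguerre polynomial replaced by `P`. -/
def kernelFun (l : ℝ) (P : Polynomial ℝ) (z : Cn n) (p : Heis n) : ℂ :=
  kernelPhase l z p * radial l P (‖z - p.1‖ ^ 2)

/-- The derivative of `kernelFun` along `X_v`. -/
def kernelFunD (l : ℝ) (P : Polynomial ℝ) (z v : Cn n) (p : Heis n) : ℂ :=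
  kernelPhase l z p * (-(l / 2 * symp v (z - p.1)) * Complex.I * radial l P (‖z - p.1‖ ^ 2) -
    2 * inner ℝ (z - p.1) v * radial l (radialD l P) (‖z - p.1‖ ^ 2))

/-- The second derivative of `kernelFun` along `X_v`. -/
def kernelFunD2 (l : ℝ) (P : Polynomial ℝ) (z v : Cn n) (p : Heis n) : ℂ :=
  kernelPhase l z p * (-(l ^ 2 / 4 * symp v (z - p.1) ^ 2) * radial l P (‖z - p.1‖ ^ 2) +
    2 * l * Complex.I * (symp v (z - p.1) * inner ℝ (z - p.1) v) *
      radial l (radialD l P) (‖z - p.1‖ ^ 2) +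
    2 * ‖v‖ ^ 2 * radial l (radialD l P) (‖z - p.1‖ ^ 2) +
    4 * inner ℝ (z - p.1) v ^ 2 * radial l (radialD l (radialD l P)) (‖z - p.1‖ ^ 2))

theorem hasTemperateGrowth_kernelFun (l : ℝ) (P : Polynomial ℝ) (z : Cn n) :
    (kernelFun l P z).HasTemperateGrowth :=
  (hasTemperateGrowth_kernelPhase l z).mul (hasTemperateGrowth_radial l P z)

theorem hasTemperateGrowth_kernelFunD (l : ℝ) (P : Polynomial ℝ) (z v : Cn n) :
    (kernelFunD l P z v).HasTemperateGrowth := by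
  have hs : (fun p : Heis n => (symp v (z - p.1) : ℂ)).HasTemperateGrowth := by
    refine hasTemperateGrowth_ofReal ?_
    simp only [symp_swap v, symp_eq_inner]
    exact ((Function.hasTemperateGrowth_inner_right _).comp (hasTemperateGrowth_sub_fst z)).neg
  have hi : (fun p : Heis n => ((inner ℝ (z - p.1) v : ℝ) : ℂ)).HasTemperateGrowth :=
    hasTemperateGrowth_ofReal
      ((Function.hasTemperateGrowth_inner_left _).comp (hasTemperateGrowth_sub_fst z))
  exact (hasTemperateGrowth_kernelPhase l z).mul
    (((((Function.HasTemperateGrowth.const _).mul hs).neg.mul (.const _)).mul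
      (hasTemperateGrowth_radial l P z)).sub
    (((Function.HasTemperateGrowth.const _).mul hi).mul
      (hasTemperateGrowth_radial l (radialD l P) z)))

theorem fderiv_eq_of_hasDerivAt_line {f : Heis n → ℂ} (hf : f.HasTemperateGrowth) {p d : Heis n}
    {c : ℂ} (h : HasDerivAt (fun t : ℝ => f (p + t • d)) c 0) : fderiv ℝ f p d = c := by
  have hd := ((hf.1.differentiable (by simp) p).hasFDerivAt).hasLineDerivAt d
  exact hd.unique h

theorem fderiv_kernelFun (l : ℝ) (P : Polynomial ℝ) (z v : Cn n) (p : Heis n) :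
    fderiv ℝ (kernelFun l P z) p (horizontal v p) = kernelFunD l P z v p := by
  refine fderiv_eq_of_hasDerivAt_line (hasTemperateGrowth_kernelFun l P z) ?_
  refine ((hasDerivAt_kernelPhase l z v p).mul (hasDerivAt_radial_line l P z v p)).congr_deriv ?_
  simp only [zero_smul, add_zero, kernelFunD]
  push_cast
  ring

theorem fderiv_kernelFunD (l : ℝ) (P : Polynomial ℝ) (z v : Cn n) (p : Heis n) :
    fderiv ℝ (kernelFunD l P z v) p (horizontal v p) = kernelFunD2 l P z v p := by
  refine fderiv_eq_of_hasDerivAt_line (hasTemperateGrowth_kernelFunD l P z v) ?_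
  -- The factor `symp v (z - p.1)` is constant along the line because `symp v v = 0`, so it is not
  -- differentiated.
  have e1 : ∀ t : ℝ, symp v (z - (p + t • horizontal v p).1) = symp v (z - p.1) := by
    intro t
    have : z - (p + t • horizontal v p).1 = (z - p.1) - t • v := by
      simp [horizontal]
      abel
    rw [this, symp_sub_right _ (z - p.1), symp_swap v (t • v), symp_smul_left, symp_self]
    ring
  have hi : HasDerivAt (fun t : ℝ => ((inner ℝ (z - (p + t • horizontal v p).1) v : ℝ) : ℂ))
      ((-‖v‖ ^ 2 : ℝ) : ℂ) 0 := by
    refine HasDerivAt.ofReal_comp ?_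
    have e : ∀ t : ℝ, inner ℝ (z - (p + t • horizontal v p).1) v =
        inner ℝ (z - p.1) v - t * ‖v‖ ^ 2 := by
      intro t
      have : z - (p + t • horizontal v p).1 = (z - p.1) - t • v := by
        simp [horizontal]
        abel
      rw [this, inner_sub_left (z - p.1), real_inner_smul_left, real_inner_self_eq_norm_sq]
    simp_rw [e]
    refine (((hasDerivAt_id (0 : ℝ)).mul_const (‖v‖ ^ 2)).const_sub _).congr_deriv ?_
    simp
  unfold kernelFunD
  simp_rw [e1]
  have h0 := hasDerivAt_radial_line l P z v p
  have h1 := hasDerivAt_radial_line l (radialD l P) z v p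
  refine ((hasDerivAt_kernelPhase l z v p).mul ((h0.const_mul
    (-(l / 2 * symp v (z - p.1)) * Complex.I : ℂ)).sub
    ((hi.const_mul 2).mul h1))).congr_deriv ?_
  simp only [zero_smul, add_zero, kernelFunD2, Pi.sub_apply, Pi.mul_apply]
  push_cast
  linear_combination (kernelPhase l z p * (l / 2 * symp v (z - p.1)) ^ 2 *
    radial l P (‖z - p.1‖ ^ 2)) * Complex.I_sq

/-- The functions `e_{k,λ}` are eigenfunctions of the sublaplacian. -/
theorem sum_kernelFunD2 (hn : 1 ≤ n) (k : ℕ) (l : ℝ) (z : Cn n) (p : Heis n) :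
    ∑ i, kernelFunD2 l (laguerrePoly (n - 1) k) z (stdOrthonormalBasis ℝ (Cn n) i) p =
      -((2 * k + n) * |l| : ℝ) * kernelFun l (laguerrePoly (n - 1) k) z p := by
  set b := stdOrthonormalBasis ℝ (Cn n)
  set u := z - p.1
  set P := laguerrePoly (n - 1) k
  have hs : ∀ i, symp (b i) u = inner ℝ (Complex.I • u) (b i) := fun i => symp_eq_inner _ _
  -- Parseval in a real orthonormal basis of `ℂⁿ` evaluates the four sums. The cross term `s2`
  -- vanishes since `I • u` is orthogonal to `u`; the remaining ones form the radial equation.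
  have s1 : ∑ i, symp (b i) u ^ 2 = ‖u‖ ^ 2 := by
    have h := b.sum_inner_mul_inner (Complex.I • u) (Complex.I • u)
    rw [real_inner_self_eq_norm_sq, norm_smul, Complex.norm_I, one_mul] at h
    rw [← h]
    refine Finset.sum_congr rfl fun i _ => ?_
    rw [hs, real_inner_comm (Complex.I • u) (b i), sq]
  have s2 : ∑ i, symp (b i) u * inner ℝ u (b i) = 0 := by
    have h := b.sum_inner_mul_inner (Complex.I • u) u
    rw [← symp_eq_inner, symp_self] at h
    rw [← h]
    refine Finset.sum_congr rfl fun i _ => ?_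
    rw [hs, real_inner_comm u (b i)]
  have s3 : ∑ i, inner ℝ u (b i) ^ 2 = ‖u‖ ^ 2 := by
    have h := b.sum_inner_mul_inner u u
    rw [real_inner_self_eq_norm_sq] at h
    rw [← h]
    refine Finset.sum_congr rfl fun i _ => ?_
    rw [real_inner_comm u (b i), sq]
  have s4 : ∑ i, ‖b i‖ ^ 2 = 2 * n := by
    simp [b.orthonormal.1]
    rw [finrank_Cn]
    push_cast
    ring
  have ode := radial_laguerrePoly_ode hn k l (‖u‖ ^ 2)
  have hC : ∀ f : Fin (Module.finrank ℝ (Cn n)) → ℝ, ∑ i, (f i : ℂ) = ((∑ i, f i : ℝ) : ℂ) :=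
    fun f => (Complex.ofReal_sum _ _).symm
  simp only [kernelFunD2, ← Finset.mul_sum, Finset.sum_add_distrib, ← Finset.sum_mul]
  have t1 : ∑ i, -((l : ℂ) ^ 2 / 4 * (symp (b i) u : ℂ) ^ 2) =
      ((-(l ^ 2 / 4 * ‖u‖ ^ 2) : ℝ) : ℂ) := by
    rw [← s1, Finset.sum_neg_distrib, ← Finset.mul_sum]
    push_cast
    rfl
  have t2 : ∑ i, (symp (b i) u : ℂ) * ((inner ℝ u (b i) : ℝ) : ℂ) = 0 := by
    have := congrArg Complex.ofReal s2
    push_cast at this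
    exact this
  have t3 : ∑ i, ((inner ℝ u (b i) : ℝ) : ℂ) ^ 2 = (‖u‖ ^ 2 : ℝ) := by
    rw [← s3]
    push_cast
    rfl
  have t4 : ∑ i, (‖b i‖ : ℂ) ^ 2 = (2 * n : ℝ) := by
    rw [← s4]
    push_cast
    rfl
  change kernelPhase l z p * ((∑ i, -((l : ℂ) ^ 2 / 4 * (symp (b i) u : ℂ) ^ 2)) *
    (radial l P (‖u‖ ^ 2) : ℂ) + 2 * l * Complex.I *
    (∑ i, (symp (b i) u : ℂ) * ((inner ℝ u (b i) : ℝ) : ℂ)) * (radial l (radialD l P) (‖u‖ ^ 2) : ℂ) +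
    2 * (∑ i, (‖b i‖ : ℂ) ^ 2) * (radial l (radialD l P) (‖u‖ ^ 2) : ℂ) +
    4 * (∑ i, ((inner ℝ u (b i) : ℝ) : ℂ) ^ 2) *
      (radial l (radialD l (radialD l P)) (‖u‖ ^ 2) : ℂ)) =
    -((2 * k + n) * |l| : ℝ) * (kernelPhase l z p * (radial l P (‖u‖ ^ 2) : ℂ))
  rw [t1, t2, t3, t4]
  have ode' := congrArg Complex.ofReal ode
  push_cast at ode' ⊢
  linear_combination kernelPhase l z p * ode'

/-- The sublaplacian of `ℍⁿ` (a nonnegative operator) on Schwartz functions. -/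
def sublaplacian (f : 𝓢(Heis n, ℂ)) : 𝓢(Heis n, ℂ) :=
  -∑ i, horizontalDeriv (stdOrthonormalBasis ℝ (Cn n) i)
    (horizontalDeriv (stdOrthonormalBasis ℝ (Cn n) i) f)

theorem integral_mul_kernelFun_integrable (f : 𝓢(Heis n, ℂ)) (l : ℝ) (P : Polynomial ℝ)
    (z : Cn n) : Integrable fun p => f p * kernelFun l P z p := by
  have hK := hasTemperateGrowth_kernelFun l P z
  refine (SchwartzMap.smulLeftCLM ℂ (kernelFun l P z) f).integrable.congr
    (Eventually.of_forall fun p => ?_)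
  rw [SchwartzMap.smulLeftCLM_apply_apply hK, smul_eq_mul, mul_comm]

/-- Green's formula moves each `X_v²` onto the kernel, where `sum_kernelFunD2` supplies the
eigenvalue. -/
theorem integral_sublaplacian_mul_kernelFun (hn : 1 ≤ n) (f : 𝓢(Heis n, ℂ)) (k : ℕ) (l : ℝ)
    (z : Cn n) :
    ∫ p, sublaplacian f p * kernelFun l (laguerrePoly (n - 1) k) z p =
      ((2 * k + n) * |l| : ℝ) * ∫ p, f p * kernelFun l (laguerrePoly (n - 1) k) z p := by
  set P := laguerrePoly (n - 1) k
  set b := stdOrthonormalBasis ℝ (Cn n)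
  have hg : ∀ i, ∫ p, horizontalDeriv (b i) (horizontalDeriv (b i) f) p * kernelFun l P z p =
      ∫ p, f p * kernelFunD2 l P z (b i) p := fun i =>
    integral_horizontalDeriv_horizontalDeriv_mul (b i) f (hasTemperateGrowth_kernelFun l P z)
      (hasTemperateGrowth_kernelFunD l P z (b i)) (fderiv_kernelFun l P z (b i))
      (fderiv_kernelFunD l P z (b i))
  have hi : ∀ i, Integrable fun p => f p * kernelFunD2 l P z (b i) p := by
    intro i
    have hK := hasTemperateGrowth_fderiv (hasTemperateGrowth_kernelFunD l P z (b i))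
    have h1 : ∀ p, kernelFunD2 l P z (b i) p =
        fderiv ℝ (kernelFunD l P z (b i)) p (horizontal (b i) p) := fun p =>
      (fderiv_kernelFunD l P z (b i) p).symm
    have hhor : (horizontal (b i)).HasTemperateGrowth := by
      have e : horizontal (b i) = fun p => ContinuousLinearMap.inl ℝ (Cn n) ℝ (b i) +
          ContinuousLinearMap.inr ℝ (Cn n) ℝ (1 / 2 * symp p.1 (b i)) := by
        funext p
        simp [horizontal]
      rw [e]
      exact (Function.HasTemperateGrowth.const _).add
        ((ContinuousLinearMap.inr ℝ (Cn n) ℝ).hasTemperateGrowth.comp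
          ((Function.HasTemperateGrowth.const _).mul (hasTemperateGrowth_symp_left _)))
    have h2 : (kernelFunD2 l P z (b i)).HasTemperateGrowth := by
      rw [funext h1]
      exact (ContinuousLinearMap.id ℝ (Heis n →L[ℝ] ℂ)).bilinear_hasTemperateGrowth hK hhor
    refine (SchwartzMap.smulLeftCLM ℂ (kernelFunD2 l P z (b i)) f).integrable.congr
      (Eventually.of_forall fun p => ?_)
    rw [SchwartzMap.smulLeftCLM_apply_apply h2, smul_eq_mul, mul_comm]
  have e1 : ∀ p, sublaplacian f p * kernelFun l P z p =
      -∑ i, horizontalDeriv (b i) (horizontalDeriv (b i) f) p * kernelFun l P z p := by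
    intro p
    rw [sublaplacian, neg_apply, sum_apply, neg_mul, Finset.sum_mul]
  simp_rw [e1]
  rw [integral_neg, integral_finsetSum _ fun i _ => integral_mul_kernelFun_integrable _ _ _ _]
  simp_rw [hg]
  rw [← integral_finsetSum _ fun i _ => hi i, ← integral_neg, ← integral_const_mul]
  congr 1
  funext p
  rw [← Finset.mul_sum, sum_kernelFunD2 hn]
  ring

/-- Spectral decay: some Schwartz function has Strichartz transform `(1 + τ²)^M f̂`. -/
theorem exists_schwartz_integral_mul_kernelFun (hn : 1 ≤ n) (f : 𝓢(Heis n, ℂ)) (M : ℕ) :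
    ∃ g : 𝓢(Heis n, ℂ), ∀ (k : ℕ) (l : ℝ) (z : Cn n),
      ∫ p, g p * kernelFun l (laguerrePoly (n - 1) k) z p =
        ((1 + ((2 * k + n) * l) ^ 2) ^ M : ℝ) *
          ∫ p, f p * kernelFun l (laguerrePoly (n - 1) k) z p := by
  induction M with
  | zero => exact ⟨f, fun k l z => by simp⟩
  | succ M ih =>
    obtain ⟨g, hg⟩ := ih
    -- Applying `1 + 𝓛²`, with `𝓛` the sublaplacian, multiplies the transform by `1 + ((2k+n)λ)²`.
    refine ⟨g + sublaplacian (sublaplacian g), fun k l z => ?_⟩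
    simp only [add_apply, add_mul]
    rw [integral_add (integral_mul_kernelFun_integrable _ _ _ _)
      (integral_mul_kernelFun_integrable _ _ _ _), integral_sublaplacian_mul_kernelFun hn,
      integral_sublaplacian_mul_kernelFun hn, hg]
    have : ((2 * k + n) * |l|) * ((2 * k + n) * |l|) = ((2 * k + n) * l) ^ 2 := by
      rw [mul_mul_mul_comm, abs_mul_abs_self]
      ring
    rw [← mul_assoc, ← mul_assoc, ← Complex.ofReal_mul, this]
    push_cast
    ring

end

/-! ### The measure on the fan, and Fourier analysis in the central variable. -/

section

open Filter Topology
open scoped FourierTransform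

variable {n : ℕ}

/-- The first coordinate is a measurable left inverse, and the range is measurable. Changes of
variables along an embedding need no measurability of the integrand on the fan. -/
theorem measurableEmbedding_ray (n k : ℕ) : MeasurableEmbedding (ray n k) := by
  have hm : Measurable (ray n k) := by
    refine Measurable.subtype_mk ?_
    fun_prop
  have hm2 : Measurable fun a : fan n => a.1.1 := measurable_subtype_coe.fst
  refine MeasurableEmbedding.of_measurable_inverse hm ?_ hm2 (fun l => rfl)
  have : Set.range (ray n k) = {a : fan n | a.1.2 = (2 * k + n) * |a.1.1|} := by
    ext a
    constructor
    · rintro ⟨l, rfl⟩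
      rfl
    · intro h
      refine ⟨a.1.1, Subtype.ext (Prod.ext rfl ?_)⟩
      exact h.symm
  rw [this]
  refine measurableSet_eq_fun measurable_subtype_coe.snd ?_
  fun_prop

/-- The density `(2π)^{-2n-1} |λ|^{2n}` of `ν` along each ray. -/
def rayWeight (n : ℕ) (l : ℝ) : ℝ := ((2 * Real.pi) ^ (2 * n + 1))⁻¹ * |l| ^ (2 * n)

theorem rayWeight_nonneg (n : ℕ) (l : ℝ) : 0 ≤ rayWeight n l := by
  unfold rayWeight
  positivity

theorem continuous_rayWeight (n : ℕ) : Continuous (rayWeight n) := by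
  unfold rayWeight
  fun_prop

theorem ae_fanMeasure {p : fan n → Prop} (h : ∀ k, ∀ᵐ l : ℝ, p (ray n k l)) :
    ∀ᵐ a ∂(fanMeasure n), p a := by
  unfold fanMeasure
  rw [Measure.ae_sum_iff]
  intro k
  rw [(measurableEmbedding_ray n k).ae_map_iff]
  exact (withDensity_absolutelyContinuous _ _).ae_le (h k)

theorem integrable_fanMeasure_iff {E : Type*} [NormedAddCommGroup E] [NormedSpace ℝ E]
    {g : fan n → E} : Integrable g (fanMeasure n) ↔
      (∀ k, Integrable fun l => rayWeight n l • g (ray n k l)) ∧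
      Summable fun k => ∫ l, rayWeight n l * ‖g (ray n k l)‖ := by
  have hw : Measurable fun l => ENNReal.ofReal (rayWeight n l) :=
    (continuous_rayWeight n).measurable.ennreal_ofReal
  change Integrable g (Measure.sum fun k : ℕ =>
    ((volume : Measure ℝ).withDensity fun l => ENNReal.ofReal (rayWeight n l)).map (ray n k)) ↔ _
  rw [integrable_sum_measure_iff]
  refine and_congr (forall_congr' fun k => ?_) (iff_of_eq (congrArg Summable (funext fun k => ?_)))
  · rw [(measurableEmbedding_ray n k).integrable_map_iff,
      integrable_withDensity_iff_integrable_smul' hw (by simp)]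
    simp_rw [ENNReal.toReal_ofReal (rayWeight_nonneg n _)]
    rfl
  · rw [(measurableEmbedding_ray n k).integral_map,
      integral_withDensity_eq_integral_toReal_smul hw (by simp)]
    simp_rw [ENNReal.toReal_ofReal (rayWeight_nonneg n _)]
    rfl

theorem hasSum_integral_fanMeasure {E : Type*} [NormedAddCommGroup E] [NormedSpace ℝ E]
    {g : fan n → E} (hg : Integrable g (fanMeasure n)) :
    HasSum (fun k => ∫ l, rayWeight n l • g (ray n k l)) (∫ a, g a ∂(fanMeasure n)) := by
  have hw : Measurable fun l => ENNReal.ofReal (rayWeight n l) :=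
    (continuous_rayWeight n).measurable.ennreal_ofReal
  have h := hasSum_integral_measure (μ := fun k : ℕ =>
    ((volume : Measure ℝ).withDensity fun l => ENNReal.ofReal (rayWeight n l)).map (ray n k)) hg
  refine HasSum.of_eq h (fun k => ?_) rfl
  rw [(measurableEmbedding_ray n k).integral_map,
      integral_withDensity_eq_integral_toReal_smul hw (by simp)]
  simp_rw [ENNReal.toReal_ofReal (rayWeight_nonneg n _)]

/-- The rays meet `R_∞` only at `λ = 0`; discarding this null set removes the Bessel case of `eFan`.
-/
theorem ae_ne_zero : ∀ᵐ l : ℝ, l ≠ 0 := by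
  simp [ae_iff]

theorem eFan_ray (k : ℕ) {l : ℝ} (hl : l ≠ 0) (p : Heis n) : eFan (ray n k l) p = eKL n k l p := by
  rw [eFan, fanIndex_ray n k hl]
  simp [ray, hl]

theorem eFan_ray_inv_mul (k : ℕ) {l : ℝ} (hl : l ≠ 0) (p : Heis n) (z : Cn n) :
    eFan (ray n k l) (heisMul (heisInv p) (z, 0)) =
      kernelFun l (laguerrePoly (n - 1) k) z p := by
  have e : (∑ i, -p.1 i * (starRingEnd ℂ) (z i)).im = symp (-p.1) z := by simp [symp]
  rw [eFan_ray k hl, eKL, kernelFun, kernelPhase, ← laguerreFun_eq_radial]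
  simp only [heisMul, heisInv, PiLp.neg_apply, e, symp_neg_left]
  rw [neg_add_eq_sub p.1 z]
  congr 2
  push_cast
  ring

theorem eFan_ray_mul (k : ℕ) {l : ℝ} (hl : l ≠ 0) (w z : Cn n) (t : ℝ) :
    eFan (ray n k l) (heisMul (-w, 0) (z, t)) =
      Complex.exp ((l * t : ℝ) * Complex.I) * (laguerreFun n k l (z - w) * twist l w z) := by
  have e : (∑ i, -w i * (starRingEnd ℂ) (z i)).im = symp (-w) z := by simp [symp]
  rw [eFan_ray k hl, eKL, twist, mul_left_comm, ← Complex.exp_add, mul_comm]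
  simp only [heisMul, PiLp.neg_apply, e, symp_neg_left]
  rw [neg_add_eq_sub]
  congr 2
  push_cast
  ring

/-- The partial Fourier transform `f^λ(w) = ∫ f(w, s) e^{-iλs} ds`. -/
def partialFourier (f : Heis n → ℂ) (l : ℝ) (w : Cn n) : ℂ :=
  ∫ s, f (w, s) * Complex.exp ((-(l * s) : ℝ) * Complex.I)

theorem integrable_mul_character {f : Heis n → ℂ} (hf : Integrable f) (l : ℝ) :
    Integrable (fun p : Heis n => f p * Complex.exp ((-(l * p.2) : ℝ) * Complex.I))
      ((volume : Measure (Cn n)).prod volume) := by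
  refine hf.norm.mono' (hf.aestronglyMeasurable.mul
    (by fun_prop : Continuous _).aestronglyMeasurable) (Eventually.of_forall fun p => ?_)
  rw [norm_mul, Complex.norm_exp_ofReal_mul_I, mul_one]

theorem integrable_partialFourier {f : Heis n → ℂ} (hf : Integrable f) (l : ℝ) :
    Integrable (partialFourier f l) :=
  (integrable_mul_character hf l).integral_prod_left

/-- The central variable enters `e_{k,λ}` only through a character, so Fubini integrates it out, and
the group law leaves the twist behind. -/
theorem strichartzTransform_ray (hn : 1 ≤ n) {f : Heis n → ℂ} (hf : Integrable f) (k : ℕ) {l : ℝ}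
    (hl : l ≠ 0) (z : Cn n) :
    strichartzTransform f (ray n k l) z =
      twistedConv l (partialFourier f l) (fun w => (laguerreFun n k l w : ℂ)) z := by
  have hc := continuous_laguerreFun_right (n := n) k l
  have e : ∀ p : Heis n, f p * eFan (ray n k l) (heisMul (heisInv p) (z, 0)) =
      f p * Complex.exp ((-(l * p.2) : ℝ) * Complex.I) *
        (laguerreFun n k l (z - p.1) * twist l p.1 z) := by
    intro p
    rw [eFan_ray_inv_mul k hl, kernelFun, ← laguerreFun_eq_radial, kernelPhase, twist,
      mul_assoc, mul_left_comm (Complex.exp _) ((laguerreFun n k l _ : ℝ) : ℂ), ← Complex.exp_add,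
      mul_comm ((laguerreFun n k l _ : ℝ) : ℂ)]
    congr 3
    push_cast
    ring
  have hint : Integrable (fun p : Heis n => f p * Complex.exp ((-(l * p.2) : ℝ) * Complex.I) *
        (laguerreFun n k l (z - p.1) * twist l p.1 z)) ((volume : Measure (Cn n)).prod volume) := by
    have h := integrable_mul_character hf l
    refine (h.norm.mul_const ((k + (n - 1)).choose k : ℝ)).mono' (h.aestronglyMeasurable.mul
      (by fun_prop : Continuous _).aestronglyMeasurable) (Eventually.of_forall fun p => ?_)
    rw [norm_mul _ ((laguerreFun n k l _ : ℂ) * _), norm_mul ((laguerreFun n k l _ : ℝ) : ℂ),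
      norm_twist, mul_one]
    gcongr
    exact norm_laguerreFun_le hn k hl _
  unfold strichartzTransform
  simp_rw [e]
  rw [Measure.volume_eq_prod, integral_prod _ hint]
  unfold twistedConv partialFourier
  congr 1
  funext w
  dsimp only
  rw [integral_mul_const, mul_assoc]

/-- The Fourier integral of `g ∈ L¹ ∩ L²` represents its `L²` Fourier transform. -/
theorem fourier_ae_eq_Lp_fourier {g : ℝ → ℂ} (hg : Integrable g) (hg2 : MemLp g 2) :
    𝓕 g =ᵐ[volume] (𝓕 (hg2.toLp g) : Lp (α := ℝ) ℂ 2) := by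
  have hcont : Continuous (𝓕 g) := VectorFourier.fourierIntegral_continuous
    Real.continuous_fourierChar (by fun_prop) hg
  refine ae_eq_of_integral_contDiff_smul_eq hcont.locallyIntegrable
    ((Lp.memLp _).locallyIntegrable (by norm_num)) (fun χ hχ hcc => ?_)
  let u : 𝓢(ℝ, ℂ) := (hcc.comp_left (g := Complex.ofReal) Complex.ofReal_zero).toSchwartzMap
    (Complex.ofRealCLM.contDiff.comp hχ)
  have hu : ∀ x, u x = (χ x : ℂ) := fun x => rfl
  have h := congrArg (fun T => T u) (Lp.fourier_toTemperedDistribution_eq (hg2.toLp g))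
  simp only [TemperedDistribution.fourier_apply, Lp.toTemperedDistribution_apply] at h
  -- Against a test function both transforms equal `∫ 𝓕u · g`: one by the multiplication formula,
  -- the other by the definition of the Fourier transform of a tempered distribution.
  calc _ = ∫ x, u x • 𝓕 g x := by simp [hu]
    _ = ∫ x, (𝓕 (u : ℝ → ℂ)) x • g x := by
      simpa using! (VectorFourier.integral_fourierIntegral_smul_eq_flip (L := innerₗ ℝ)
        Real.continuous_fourierChar continuous_inner u.integrable hg).symm
    _ = ∫ x, (𝓕 u) x • (hg2.toLp g : ℝ → ℂ) x := by
      refine integral_congr_ae ?_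
      filter_upwards [hg2.coeFn_toLp] with x hx
      rw [hx, SchwartzMap.fourier_coe]
    _ = _ := h
    _ = _ := by simp [hu]

theorem plancherel_fourier {g : ℝ → ℂ} (hg : Integrable g) (hg2 : MemLp g 2) :
    Integrable (fun ξ => ‖𝓕 g ξ‖ ^ 2) ∧ ∫ ξ, ‖𝓕 g ξ‖ ^ 2 = ∫ s, ‖g s‖ ^ 2 := by
  have hae := fourier_ae_eq_Lp_fourier hg hg2
  have hm : MemLp (𝓕 g) 2 := (Lp.memLp _).ae_eq hae.symm
  refine ⟨hm.integrable_norm_pow two_ne_zero, ?_⟩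
  have h := Lp.norm_fourier_eq (hg2.toLp g)
  have hL : ∀ F : Lp (α := ℝ) ℂ 2, ‖F‖ ^ 2 = ∫ x, ‖F x‖ ^ 2 := by
    intro F
    have h1 := L2.inner_def (𝕜 := ℂ) F F
    rw [inner_self_eq_norm_sq_to_K] at h1
    have h2 : ∀ x, inner ℂ (F x) (F x) = ((‖F x‖ ^ 2 : ℝ) : ℂ) := fun x => by
      rw [inner_self_eq_norm_sq_to_K]
      simp
    simp_rw [h2] at h1
    rw [integral_complex_ofReal] at h1
    exact Complex.ofReal_injective (by simpa using h1)
  have h3 := congrArg (· ^ 2) h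
  simp only [hL] at h3
  calc _ = _ := integral_congr_ae (by filter_upwards [hae] with x hx; rw [hx])
    _ = _ := h3
    _ = _ := integral_congr_ae (by filter_upwards [hg2.coeFn_toLp] with x hx; rw [hx])

/-- The transform `𝓕` carries `2π` in its exponent; rescaling the frequency is the source of the
factor `2π` in Plancherel and inversion. -/
theorem integral_mul_character_eq_fourier (g : ℝ → ℂ) (l : ℝ) :
    ∫ s, g s * Complex.exp ((-(l * s) : ℝ) * Complex.I) = 𝓕 g (l / (2 * Real.pi)) := by
  rw [Real.fourier_eq']
  congr 1
  funext s
  rw [smul_eq_mul, mul_comm]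
  congr 3
  have := Real.pi_ne_zero
  simp
  field_simp

theorem plancherel_character {g : ℝ → ℂ} (hg : Integrable g) (hg2 : MemLp g 2) :
    Integrable (fun l : ℝ => ‖∫ s, g s * Complex.exp ((-(l * s) : ℝ) * Complex.I)‖ ^ 2) ∧
      ∫ l : ℝ, ‖∫ s, g s * Complex.exp ((-(l * s) : ℝ) * Complex.I)‖ ^ 2 =
        2 * Real.pi * ∫ s, ‖g s‖ ^ 2 := by
  simp_rw [integral_mul_character_eq_fourier]
  obtain ⟨h1, h2⟩ := plancherel_fourier hg hg2
  refine ⟨h1.comp_div (by positivity), ?_⟩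
  rw [Measure.integral_comp_div (fun ξ => ‖𝓕 g ξ‖ ^ 2), h2, abs_of_pos (by positivity), smul_eq_mul]

theorem aestronglyMeasurable_partialFourier {f : Heis n → ℂ} (hf : Integrable f) :
    AEStronglyMeasurable (fun p : ℝ × Cn n => partialFourier f p.1 p.2)
      (volume.prod volume) := by
  have h : AEStronglyMeasurable (fun q : (ℝ × Cn n) × ℝ => f (q.1.2, q.2) *
      Complex.exp ((-(q.1.1 * q.2) : ℝ) * Complex.I)) ((volume.prod volume).prod volume) := by
    refine AEStronglyMeasurable.mul ?_ (by fun_prop : Continuous _).aestronglyMeasurable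
    have hq : Measure.QuasiMeasurePreserving (fun q : (ℝ × Cn n) × ℝ => (q.1.2, q.2))
        (((volume : Measure ℝ).prod (volume : Measure (Cn n))).prod (volume : Measure ℝ))
        ((volume : Measure (Cn n)).prod volume) :=
      QuasiMeasurePreserving.prodMap (Measure.quasiMeasurePreserving_snd (μ := (volume : Measure ℝ))
        (ν := (volume : Measure (Cn n)))) (.id _)
    exact hf.aestronglyMeasurable.comp_quasiMeasurePreserving hq
  exact h.integral_prod_right'

/-- The Plancherel formula in the central variable. -/
theorem integrable_normSq_partialFourier {f : Heis n → ℂ} (hf : Integrable f) (hf2 : MemLp f 2) :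
    Integrable (fun p : ℝ × Cn n => ‖partialFourier f p.1 p.2‖ ^ 2) (volume.prod volume) ∧
      ∫ l, ∫ w, ‖partialFourier f l w‖ ^ 2 = 2 * Real.pi * ∫ p, ‖f p‖ ^ 2 := by
  have hsq : Integrable (fun p => ‖f p‖ ^ 2) ((volume : Measure (Cn n)).prod (volume : Measure ℝ)) :=
    hf2.integrable_norm_pow two_ne_zero
  have hf' : Integrable f ((volume : Measure (Cn n)).prod (volume : Measure ℝ)) := hf
  have hslice : ∀ᵐ w : Cn n, Integrable (fun s => f (w, s)) ∧ MemLp (fun s => f (w, s)) 2 := by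
    filter_upwards [hf'.prod_right_ae, hsq.prod_right_ae] with w h1 h2
    exact ⟨h1, (memLp_two_iff_integrable_sq_norm h1.aestronglyMeasurable).2 h2⟩
  have hint : Integrable (fun p : ℝ × Cn n => ‖partialFourier f p.1 p.2‖ ^ 2)
      (volume.prod volume) := by
    have hm : AEStronglyMeasurable (fun p : ℝ × Cn n => ‖partialFourier f p.1 p.2‖ ^ 2)
        (volume.prod volume) := (aestronglyMeasurable_partialFourier hf).norm.pow 2
    rw [integrable_prod_iff' hm]
    constructor
    · filter_upwards [hslice] with w hw
      exact (plancherel_character hw.1 hw.2).1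
    · refine (hsq.integral_prod_left.const_mul (2 * Real.pi)).congr ?_
      filter_upwards [hslice] with w hw
      rw [← (plancherel_character hw.1 hw.2).2]
      congr 1
      funext l
      rw [Real.norm_of_nonneg (by positivity)]
      rfl
  refine ⟨hint, ?_⟩
  rw [integral_integral_swap hint, Measure.volume_eq_prod, integral_prod _ hsq,
    ← integral_const_mul]
  refine integral_congr_ae ?_
  filter_upwards [hslice] with w hw
  exact (plancherel_character hw.1 hw.2).2

end

/-! ### Plancherel and inversion on the fan. -/

section

open Filter Topology
open scoped FourierTransform

variable {n : ℕ}

theorem strichartzTransform_ray_eq_integral (f : Heis n → ℂ) (k : ℕ) {l : ℝ} (hl : l ≠ 0)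
    (z : Cn n) : strichartzTransform f (ray n k l) z =
      ∫ p, f p * kernelFun l (laguerrePoly (n - 1) k) z p := by
  unfold strichartzTransform
  simp_rw [eFan_ray_inv_mul k hl]

theorem continuous_kernelFun (k : ℕ) : Continuous fun q : (ℝ × Cn n) × Heis n =>
    kernelFun q.1.1 (laguerrePoly (n - 1) k) q.1.2 q.2 := by
  unfold kernelFun kernelPhase
  simp_rw [← laguerreFun_eq_radial]
  have h : Continuous fun q : (ℝ × Cn n) × Heis n => laguerreFun n k q.1.1 (q.1.2 - q.2.1) := by
    have h0 := continuous_laguerre (n - 1) k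
    unfold laguerreFun
    fun_prop
  exact Continuous.mul (by fun_prop) (Complex.continuous_ofReal.comp h)

theorem norm_kernelFun_le (hn : 1 ≤ n) (k : ℕ) {l : ℝ} (hl : l ≠ 0) (z : Cn n) (p : Heis n) :
    ‖kernelFun l (laguerrePoly (n - 1) k) z p‖ ≤ ((k + (n - 1)).choose k : ℝ) := by
  rw [kernelFun, kernelPhase, ← laguerreFun_eq_radial, norm_mul, Complex.norm_exp_ofReal_mul_I,
    one_mul]
  exact norm_laguerreFun_le hn k hl _

/-- The Strichartz transform along the `k`-th ray as a jointly measurable function. -/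
theorem aestronglyMeasurable_integral_kernelFun {f : Heis n → ℂ}
    (hf : AEStronglyMeasurable f volume) (k : ℕ) :
    AEStronglyMeasurable (fun q : ℝ × Cn n =>
      ∫ p, f p * kernelFun q.1 (laguerrePoly (n - 1) k) q.2 p) (volume.prod volume) := by
  have h : AEStronglyMeasurable (fun q : (ℝ × Cn n) × Heis n =>
      f q.2 * kernelFun q.1.1 (laguerrePoly (n - 1) k) q.1.2 q.2)
      ((volume.prod volume).prod volume) :=
    hf.comp_snd.mul (continuous_kernelFun k).aestronglyMeasurable
  exact h.integral_prod_right'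

theorem ae_ray_aestronglyMeasurable_integral {f : Heis n → ℂ}
    (hf : AEStronglyMeasurable f volume) (k : ℕ) :
    AEStronglyMeasurable (fun l : ℝ => ∫ w, ‖strichartzTransform f (ray n k l) w‖ ^ 2) volume := by
  have h : AEStronglyMeasurable (fun q : ℝ × Cn n =>
      ‖∫ p, f p * kernelFun q.1 (laguerrePoly (n - 1) k) q.2 p‖ ^ 2) (volume.prod volume) :=
    (aestronglyMeasurable_integral_kernelFun hf k).norm.pow 2
  refine h.integral_prod_right'.congr ?_
  filter_upwards [ae_ne_zero] with l hl
  simp_rw [strichartzTransform_ray_eq_integral f k hl]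

/-- The density of `ν` exactly cancels the squared normalization of the projections, leaving the
constant of one-dimensional Fourier analysis. -/
theorem rayWeight_mul_twistConst_sq {l : ℝ} (hl : l ≠ 0) :
    rayWeight n l * twistConst n l ^ 2 = (2 * Real.pi)⁻¹ := by
  have hl' : 0 < |l| := abs_pos.2 hl
  have hpi := Real.pi_pos
  unfold rayWeight twistConst
  rw [div_pow, div_pow, ← pow_mul, ← pow_mul, mul_comm n 2, pow_succ]
  field_simp

theorem integrable_normSq_strichartzTransform_ray (hn : 1 ≤ n) {f : Heis n → ℂ}
    (hf : Integrable f) (k : ℕ) {l : ℝ} (hl : l ≠ 0) :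
    Integrable fun w => ‖strichartzTransform f (ray n k l) w‖ ^ 2 := by
  simp_rw [strichartzTransform_ray hn hf k hl]
  have hF := integrable_partialFourier hf l
  have hT := integrable_twistedConv (l := l) hF (integrable_ofReal_laguerreFun hn k hl)
  refine (hT.norm.mul_const (((k + (n - 1)).choose k : ℝ) * ∫ w, ‖partialFourier f l w‖)).mono'
    (hT.aestronglyMeasurable.norm.pow 2) (Eventually.of_forall fun w => ?_)
  rw [norm_pow, norm_norm, sq]
  gcongr
  exact norm_twistedConv_le hF (norm_laguerreFun_le hn k hl) w

/-- **Plancherel formula** for the Strichartz Fourier transform. -/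
theorem plancherel_strichartzTransform (hn : 1 ≤ n) {f : Heis n → ℂ} (hf : Integrable f)
    (hf2 : MemLp f 2) :
    Integrable (fun a : fan n => ∫ w : Cn n, ‖strichartzTransform f a w‖ ^ 2) (fanMeasure n) ∧
      ∫ p : Heis n, ‖f p‖ ^ 2 =
        ∫ a : fan n, (∫ w : Cn n, ‖strichartzTransform f a w‖ ^ 2) ∂(fanMeasure n) := by
  obtain ⟨hP1, hP2⟩ := integrable_normSq_partialFourier hf hf2
  set A : ℝ → ℝ := fun l => (2 * Real.pi)⁻¹ * ∫ w, ‖partialFourier f l w‖ ^ 2 with hA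
  have hAint : Integrable A := hP1.integral_prod_left.const_mul _
  have hAval : ∫ l, A l = ∫ p, ‖f p‖ ^ 2 := by
    rw [integral_const_mul, hP2, ← mul_assoc, inv_mul_cancel₀ (by positivity), one_mul]
  -- For almost every `λ` the slice `f^λ` lies in `L¹ ∩ L²`, so the Laguerre Plancherel formula
  -- applies. All terms are nonnegative, so integrability of the sum `A` justifies exchanging sum
  -- and integral.
  have hsum : ∀ᵐ l : ℝ, HasSum (fun k => rayWeight n l *
      ∫ w, ‖strichartzTransform f (ray n k l) w‖ ^ 2) (A l) := by
    filter_upwards [ae_ne_zero, hP1.prod_right_ae] with l hl h2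
    have hF := integrable_partialFourier hf l
    have hF2 := (memLp_two_iff_integrable_sq_norm hF.aestronglyMeasurable).2 h2
    have h := (hasSum_integral_normSq_twistedConv hn hl hF hF2).mul_left (rayWeight n l)
    refine HasSum.of_eq h (fun k => ?_) ?_
    · simp_rw [strichartzTransform_ray hn hf k hl]
    · rw [← mul_assoc, rayWeight_mul_twistConst_sq hl]
  have hnn : ∀ k l, 0 ≤ rayWeight n l * ∫ w, ‖strichartzTransform f (ray n k l) w‖ ^ 2 :=
    fun k l => mul_nonneg (rayWeight_nonneg n l) (integral_nonneg fun w => by positivity)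
  have hmeas : ∀ k, AEStronglyMeasurable (fun l => rayWeight n l *
      ∫ w, ‖strichartzTransform f (ray n k l) w‖ ^ 2) volume := fun k =>
    (continuous_rayWeight n).aestronglyMeasurable.mul
      (ae_ray_aestronglyMeasurable_integral hf.aestronglyMeasurable k)
  have hterm : ∀ k, Integrable fun l => rayWeight n l *
      ∫ w, ‖strichartzTransform f (ray n k l) w‖ ^ 2 := by
    intro k
    refine hAint.mono' (hmeas k) ?_
    filter_upwards [hsum] with l hl
    rw [Real.norm_of_nonneg (hnn k l)]
    exact le_hasSum hl k fun j _ => hnn j l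
  have htot : HasSum (fun k => ∫ l, rayWeight n l *
      ∫ w, ‖strichartzTransform f (ray n k l) w‖ ^ 2) (∫ l, A l) := by
    refine hasSum_integral_of_dominated_convergence (fun k l => rayWeight n l *
      ∫ w, ‖strichartzTransform f (ray n k l) w‖ ^ 2) hmeas ?_ ?_ ?_ hsum
    · exact fun k => Eventually.of_forall fun l => (Real.norm_of_nonneg (hnn k l)).le
    · filter_upwards [hsum] with l hl
      exact hl.summable
    · refine hAint.congr ?_
      filter_upwards [hsum] with l hl
      exact hl.tsum_eq.symm
  have hint : Integrable (fun a : fan n => ∫ w : Cn n, ‖strichartzTransform f a w‖ ^ 2)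
      (fanMeasure n) := by
    rw [integrable_fanMeasure_iff]
    refine ⟨hterm, ?_⟩
    refine htot.summable.congr fun k => ?_
    congr 1
    funext l
    rw [Real.norm_of_nonneg (integral_nonneg fun w => by positivity)]
  refine ⟨hint, ?_⟩
  rw [← hAval]
  exact htot.unique (hasSum_integral_fanMeasure hint)

theorem choose_le_pow (hn : 1 ≤ n) (k : ℕ) :
    ((k + (n - 1)).choose k : ℝ) ≤ (2 * k + n : ℝ) ^ (n - 1) := by
  rw [Nat.choose_symm_add]
  have h := Nat.choose_le_pow (k + (n - 1)) (n - 1)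
  have h2 : (k + (n - 1)) ^ (n - 1) ≤ (2 * k + n) ^ (n - 1) := Nat.pow_le_pow_left (by omega) _
  exact_mod_cast h.trans h2

/-- Rapid decay of the Strichartz transform of a Schwartz function on the fan. -/
theorem exists_norm_strichartzTransform_ray_le (hn : 1 ≤ n) (f : 𝓢(Heis n, ℂ)) :
    ∃ C : ℝ, 0 ≤ C ∧ ∀ (k : ℕ) (l : ℝ) (z : Cn n), l ≠ 0 →
      |l| ^ n * ‖strichartzTransform f (ray n k l) z‖ ≤
        C * ((2 * k + n : ℝ)⁻¹ * (1 + ((2 * k + n) * l) ^ 2)⁻¹) := by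
  -- With `m = 2k + n` and `y = 1 + (mλ)²`, `n` powers of `y` absorb `(m|λ|)^n` and the last one
  -- stays for integrability in `λ`. The binomial bound costs only `m^{n-1}`, so a factor `m⁻¹` is
  -- gained.
  obtain ⟨g, hg⟩ := exists_schwartz_integral_mul_kernelFun hn f (n + 1)
  refine ⟨∫ p, ‖g p‖, integral_nonneg fun p => norm_nonneg _, fun k l z hl => ?_⟩
  have h := congrArg norm (hg k l z)
  rw [← strichartzTransform_ray_eq_integral f k hl, norm_mul, Complex.norm_real,
    Real.norm_of_nonneg (by positivity)] at h
  have hb : ‖∫ p, g p * kernelFun l (laguerrePoly (n - 1) k) z p‖ ≤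
      (2 * k + n : ℝ) ^ (n - 1) * ∫ p, ‖g p‖ := by
    rw [mul_comm, ← integral_mul_const]
    refine norm_integral_le_of_norm_le (g.integrable.norm.mul_const _)
      (Eventually.of_forall fun p => ?_)
    rw [norm_mul]
    gcongr
    exact (norm_kernelFun_le hn k hl z p).trans (choose_le_pow hn k)
  rw [h] at hb
  set m : ℝ := 2 * k + n with hm
  have hn0 : (1 : ℝ) ≤ n := by exact_mod_cast hn
  have hm0 : 0 < m := by positivity
  set G := ∫ p, ‖g p‖
  have hG : 0 ≤ G := integral_nonneg fun p => norm_nonneg _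
  set y := 1 + (m * l) ^ 2 with hy
  have hy0 : 0 < y := by positivity
  have h1 : (m * |l|) ^ n ≤ y ^ n := by
    gcongr
    rw [hy, mul_pow, ← sq_abs l, ← mul_pow]
    nlinarith [sq_nonneg (m * |l| - 1), mul_pos hm0 (abs_pos.2 hl)]
  have hmn : m ^ n = m ^ (n - 1) * m := by
    rw [← pow_succ, Nat.sub_add_cancel hn]
  set T := ‖strichartzTransform f (ray n k l) z‖
  have hT : 0 ≤ T := norm_nonneg _
  rw [← mul_inv, ← div_eq_mul_inv, le_div_iff₀ (by positivity)]
  have h2 : m ^ (n - 1) * (|l| ^ n * T * (m * y)) ≤ m ^ (n - 1) * G := by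
    calc _ = (m * |l|) ^ n * (y * T) := by rw [mul_pow, hmn]; ring
      _ ≤ y ^ n * (y * T) := by gcongr
      _ = y ^ (n + 1) * T := by ring
      _ ≤ _ := hb
  exact le_of_mul_le_mul_left h2 (by positivity)

theorem summable_inv_sq (hn : 1 ≤ n) : Summable fun k : ℕ => ((2 * k + n : ℝ) ^ 2)⁻¹ := by
  have h := (summable_nat_add_iff 1).2 (Real.summable_nat_pow_inv.2 one_lt_two)
  refine Summable.of_nonneg_of_le (fun k => by positivity) (fun k => ?_) h
  have hn0 : (1 : ℝ) ≤ n := by exact_mod_cast hn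
  push_cast
  gcongr
  linarith [(Nat.cast_nonneg k : (0 : ℝ) ≤ k)]

theorem continuous_partialFourier (f : 𝓢(Heis n, ℂ)) (l : ℝ) : Continuous (partialFourier f l) := by
  obtain ⟨C, hC⟩ : ∃ C : ℝ, ∀ p : Heis n, (1 + ‖p‖) ^ 2 * ‖f p‖ ≤ C := by
    have h := fun p => SchwartzMap.one_add_le_sup_seminorm_apply (𝕜 := ℂ) (m := (2, 0)) (k := 2)
      (n := 0) le_rfl le_rfl f p
    simp only [norm_iteratedFDeriv_zero] at h
    exact ⟨_, h⟩
  refine continuous_of_dominated (bound := fun s => C * (1 + s ^ 2)⁻¹) (fun w => ?_)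
    (fun w => Eventually.of_forall fun s => ?_) (integrable_inv_one_add_sq.const_mul C)
    (Eventually.of_forall fun s => ?_)
  · have := f.continuous
    exact (by fun_prop : Continuous _).aestronglyMeasurable
  · rw [norm_mul, Complex.norm_exp_ofReal_mul_I, mul_one, ← div_eq_mul_inv,
      le_div_iff₀ (by positivity), mul_comm]
    refine le_trans ?_ (hC (w, s))
    gcongr
    have h1 : |s| ≤ ‖(w, s)‖ := norm_snd_le (w, s)
    nlinarith [sq_abs s, abs_nonneg s]
  · have := f.continuous
    fun_prop

theorem summable_strichartzTransform_ray (hn : 1 ≤ n) (f : 𝓢(Heis n, ℂ)) {l : ℝ} (hl : l ≠ 0)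
    (z : Cn n) : Summable fun k => ‖strichartzTransform f (ray n k l) z‖ := by
  obtain ⟨C, hC0, hC⟩ := exists_norm_strichartzTransform_ray_le hn f
  have hl' : 0 < |l| := abs_pos.2 hl
  have hn0 : (1 : ℝ) ≤ n := by exact_mod_cast hn
  refine Summable.of_nonneg_of_le (fun k => norm_nonneg _) (fun k => ?_)
    ((summable_inv_sq hn).mul_left (C * (|l| ^ n * l ^ 2)⁻¹))
  have h := hC k l z hl
  have hm : (1 : ℝ) ≤ 2 * k + n := by linarith [(Nat.cast_nonneg k : (0 : ℝ) ≤ k)]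
  set m : ℝ := 2 * k + n
  have h1 : m⁻¹ * (1 + (m * l) ^ 2)⁻¹ ≤ (l ^ 2)⁻¹ * (m ^ 2)⁻¹ := by
    rw [← mul_inv, ← mul_inv]
    refine inv_anti₀ (by positivity) ?_
    nlinarith [sq_nonneg (m * l), mul_nonneg (sub_nonneg.2 hm) (sq_nonneg (m * l))]
  have h2 := h.trans (mul_le_mul_of_nonneg_left h1 hC0)
  calc _ = (|l| ^ n)⁻¹ * (|l| ^ n * ‖strichartzTransform f (ray n k l) z‖) :=
        (inv_mul_cancel_left₀ (by positivity) _).symm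
    _ ≤ (|l| ^ n)⁻¹ * (C * ((l ^ 2)⁻¹ * (m ^ 2)⁻¹)) := by gcongr
    _ = _ := by rw [mul_inv]; ring

/-- Pointwise expansion of `f^λ` into twisted convolutions with Laguerre functions. -/
theorem hasSum_strichartzTransform_ray (hn : 1 ≤ n) (f : 𝓢(Heis n, ℂ)) {l : ℝ} (hl : l ≠ 0)
    (z : Cn n) : HasSum (fun k => strichartzTransform f (ray n k l) z)
      (twistConst n l * partialFourier f l z) := by
  have hs := summable_strichartzTransform_ray hn f hl z
  have hF := integrable_partialFourier f.integrable l
  have h1 := tendsto_twistedConv_mehler hl hF (continuous_partialFourier f l).continuousAt (z := z)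
  -- The Abel means have two limits as `r → 1`: the sum itself, by dominated convergence, and `c
  -- f^λ(z)`, by the approximate identity.
  have h2 : Tendsto (fun r : ℝ => ∑' k, strichartzTransform f (ray n k l) z * (r : ℂ) ^ k) (𝓝[<] 1)
      (𝓝 (∑' k, strichartzTransform f (ray n k l) z)) := by
    refine tendsto_tsum_of_dominated_convergence hs (fun k => ?_) ?_
    · have : Tendsto (fun r : ℝ => strichartzTransform f (ray n k l) z * (r : ℂ) ^ k) (𝓝 1)
          (𝓝 (strichartzTransform f (ray n k l) z * ((1 : ℝ) : ℂ) ^ k)) :=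
        (by fun_prop : Continuous fun r : ℝ =>
          strichartzTransform f (ray n k l) z * (r : ℂ) ^ k).tendsto 1
      simp only [Complex.ofReal_one, one_pow, mul_one] at this
      exact this.mono_left nhdsWithin_le_nhds
    · filter_upwards [Ioo_mem_nhdsLT (show (0 : ℝ) < 1 by norm_num)] with r hr k
      rw [norm_mul, norm_pow, Complex.norm_real, Real.norm_of_nonneg hr.1.le]
      exact mul_le_of_le_one_right (norm_nonneg _) (pow_le_one₀ hr.1.le hr.2.le)
  have h3 : Tendsto (fun r : ℝ => ∑' k, strichartzTransform f (ray n k l) z * (r : ℂ) ^ k) (𝓝[<] 1)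
      (𝓝 (twistConst n l * partialFourier f l z)) := by
    refine h1.congr' ?_
    filter_upwards [Ioo_mem_nhdsLT (show (0 : ℝ) < 1 by norm_num)] with r hr
    have h := hasSum_twistedConv_laguerreFun_of_integrable hn hl hF
      (abs_lt.2 ⟨by linarith [hr.1], hr.2⟩) z
    rw [← h.tsum_eq]
    simp_rw [strichartzTransform_ray hn f.integrable _ hl]
  rw [tendsto_nhds_unique h3 h2]
  exact hs.of_norm.hasSum

/-- Fourier inversion in the central variable. -/
theorem integral_character_mul_partialFourier (f : 𝓢(Heis n, ℂ)) (z : Cn n) (t : ℝ) :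
    ∫ l : ℝ, ((2 * Real.pi)⁻¹ : ℝ) * (Complex.exp ((l * t : ℝ) * Complex.I) * partialFourier f l z) =
      f (z, t) := by
  have hpi := Real.pi_pos
  have htemp : (fun s : ℝ => (z, s)).HasTemperateGrowth := by
    have e : (fun s : ℝ => (z, s)) = fun s => ((z, 0) : Heis n) +
        ContinuousLinearMap.inr ℝ (Cn n) ℝ s := by
      funext s
      simp
    rw [e]
    exact (Function.HasTemperateGrowth.const _).add
      (ContinuousLinearMap.inr ℝ (Cn n) ℝ).hasTemperateGrowth
  have hanti : AntilipschitzWith 1 fun s : ℝ => (z, s) :=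
    AntilipschitzWith.of_le_mul_dist fun a b => by
      rw [Prod.dist_eq, dist_self, NNReal.coe_one, one_mul]
      exact le_max_right _ _
  -- The slice of `f` above `z` is Schwartz on `ℝ`, so ordinary Fourier inversion applies.
  let g : 𝓢(ℝ, ℂ) := SchwartzMap.compCLMOfAntilipschitz ℂ htemp hanti f
  have hg : ∀ s, g s = f (z, s) := fun s => rfl
  have hF : ∀ l, partialFourier f l z = 𝓕 g (l / (2 * Real.pi)) := by
    intro l
    rw [SchwartzMap.fourier_coe, ← integral_mul_character_eq_fourier]
    rfl
  simp_rw [hF]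
  have e1 : ∀ l : ℝ, (((2 * Real.pi)⁻¹ : ℝ) : ℂ) * (Complex.exp ((l * t : ℝ) * Complex.I) *
      𝓕 g (l / (2 * Real.pi))) = (fun ξ : ℝ => (((2 * Real.pi)⁻¹ : ℝ) : ℂ) *
        (Complex.exp ((2 * Real.pi * ξ * t : ℝ) * Complex.I) * 𝓕 g ξ)) (l / (2 * Real.pi)) := by
    intro l
    have : 2 * Real.pi * (l / (2 * Real.pi)) = l := by field_simp
    simp only [this]
  rw [integral_congr_ae (Eventually.of_forall e1), Measure.integral_comp_div (fun ξ : ℝ =>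
    (((2 * Real.pi)⁻¹ : ℝ) : ℂ) * (Complex.exp ((2 * Real.pi * ξ * t : ℝ) * Complex.I) * 𝓕 g ξ)),
    abs_of_pos (by positivity), integral_const_mul,
    Complex.real_smul, ← mul_assoc, ← Complex.ofReal_mul, mul_inv_cancel₀ (by positivity),
    Complex.ofReal_one, one_mul]
  have hinv : 𝓕⁻ (𝓕 g) = g := FourierTransform.fourierInv_fourier_eq g
  have h := congrArg (fun u : 𝓢(ℝ, ℂ) => u t) hinv
  rw [SchwartzMap.fourierInv_coe, Real.fourierInv_eq'] at h
  rw [← hg, ← h]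
  congr 1
  funext ξ
  rw [smul_eq_mul]
  congr 2
  simp
  ring

/-- The integrand is, up to `e^{iλt}`, that of `(f^λ × φ_k) × φ_k`, and the projection property
collapses the double convolution. -/
theorem integral_strichartzTransform_mul_eFan (hn : 1 ≤ n) {f : Heis n → ℂ} (hf : Integrable f)
    (k : ℕ) {l : ℝ} (hl : l ≠ 0) (z : Cn n) (t : ℝ) :
    Integrable (fun w : Cn n => strichartzTransform f (ray n k l) w *
      eFan (ray n k l) (heisMul (-w, 0) (z, t))) ∧
    ∫ w : Cn n, strichartzTransform f (ray n k l) w *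
      eFan (ray n k l) (heisMul (-w, 0) (z, t)) =
      Complex.exp ((l * t : ℝ) * Complex.I) *
        (twistConst n l * strichartzTransform f (ray n k l) z) := by
  have hF := integrable_partialFourier hf l
  have hc := continuous_laguerreFun_right (n := n) k l
  have hT := integrable_twistedConv (l := l) hF (integrable_ofReal_laguerreFun hn k hl)
  have e : ∀ w, strichartzTransform f (ray n k l) w *
      eFan (ray n k l) (heisMul (-w, 0) (z, t)) = Complex.exp ((l * t : ℝ) * Complex.I) *
        (twistedConv l (partialFourier f l) (fun w => (laguerreFun n k l w : ℂ)) w *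
          (laguerreFun n k l (z - w) : ℂ) * twist l w z) := by
    intro w
    rw [strichartzTransform_ray hn hf k hl, eFan_ray_mul k hl]
    ring
  simp_rw [e]
  constructor
  · exact (integrable_twistedConv_integrand hT (Φ := fun w => (laguerreFun n k l w : ℂ))
      (by fun_prop) (norm_laguerreFun_le hn k hl) z).const_mul _
  · rw [integral_const_mul, strichartzTransform_ray hn hf k hl,
      ← twistedConv_twistedConv_laguerreFun hn hl hF]
    rfl

theorem rayWeight_mul_twistConst {l : ℝ} (hl : l ≠ 0) :
    rayWeight n l * twistConst n l = ((2 * Real.pi) ^ (n + 1))⁻¹ * |l| ^ n := by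
  have hl' : 0 < |l| := abs_pos.2 hl
  have hpi := Real.pi_pos
  unfold rayWeight twistConst
  rw [div_pow, two_mul n, pow_succ, pow_succ, pow_add, pow_add]
  field_simp

/-- **Inversion formula** for the Strichartz Fourier transform. -/
theorem inversion_strichartzTransform (hn : 1 ≤ n) (f : 𝓢(Heis n, ℂ)) (z : Cn n) (t : ℝ) :
    Integrable (fun a : fan n =>
        ∫ w : Cn n, strichartzTransform f a w * eFan a (heisMul (-w, 0) (z, t)))
        (fanMeasure n) ∧
      f (z, t) = ∫ a : fan n, (∫ w : Cn n,
        strichartzTransform f a w * eFan a (heisMul (-w, 0) (z, t))) ∂(fanMeasure n) := by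
  obtain ⟨C, hC0, hC⟩ := exists_norm_strichartzTransform_ray_le hn f
  have hpi := Real.pi_pos
  have hn0 : (1 : ℝ) ≤ n := by exact_mod_cast hn
  have hm0 : ∀ k : ℕ, (0 : ℝ) < 2 * k + n := fun k => by positivity
  set J : ℕ → ℝ → ℂ := fun k l => ∫ w : Cn n, strichartzTransform f (ray n k l) w *
    eFan (ray n k l) (heisMul (-w, 0) (z, t)) with hJ
  have hJval : ∀ k l, l ≠ 0 → J k l = Complex.exp ((l * t : ℝ) * Complex.I) *
        (twistConst n l * strichartzTransform f (ray n k l) z) := fun k l hl =>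
    (integral_strichartzTransform_mul_eFan hn f.integrable k hl z t).2
  have hmeas : ∀ k, AEStronglyMeasurable (fun l => rayWeight n l • J k l) volume := by
    intro k
    have h0 : AEStronglyMeasurable (fun l : ℝ => ∫ p, f p *
        kernelFun l (laguerrePoly (n - 1) k) z p) volume := by
      have h : Continuous (fun q : ℝ × Heis n =>
          f q.2 * kernelFun q.1 (laguerrePoly (n - 1) k) z q.2) := by
        have h1 := (continuous_kernelFun (n := n) k).comp
          (by fun_prop : Continuous fun q : ℝ × Heis n => ((q.1, z), q.2))
        exact (f.continuous.comp continuous_snd).mul h1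
      exact (h.aestronglyMeasurable (μ := volume.prod volume)).integral_prod_right'
    have h1 : AEStronglyMeasurable (fun l : ℝ => ((rayWeight n l * twistConst n l : ℝ) : ℂ) *
        (Complex.exp ((l * t : ℝ) * Complex.I) * ∫ p, f p *
          kernelFun l (laguerrePoly (n - 1) k) z p)) volume := by
      refine AEStronglyMeasurable.mul ?_ (AEStronglyMeasurable.mul
        (by fun_prop : Continuous _).aestronglyMeasurable h0)
      refine Measurable.aestronglyMeasurable ?_
      unfold rayWeight twistConst
      fun_prop
    refine h1.congr ?_
    filter_upwards [ae_ne_zero] with l hl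
    rw [hJval k l hl, strichartzTransform_ray_eq_integral f k hl, Complex.real_smul]
    push_cast
    ring
  -- Integrating this majorant in `λ` gains a second factor `(2k+n)⁻¹` by scaling, so the integrals
  -- are summable in `k`.
  set D : ℕ → ℝ → ℝ := fun k l => ((2 * Real.pi) ^ (n + 1))⁻¹ *
    (C * ((2 * k + n : ℝ)⁻¹ * (1 + ((2 * k + n) * l) ^ 2)⁻¹)) with hD
  have hDint : ∀ k, Integrable (D k) := fun k =>
    (((integrable_inv_one_add_sq.comp_mul_left' (hm0 k).ne').const_mul _).const_mul _).const_mul _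
  have hDval : ∀ k, ∫ l, D k l = ((2 * Real.pi) ^ (n + 1))⁻¹ * C * Real.pi *
      ((2 * k + n : ℝ) ^ 2)⁻¹ := by
    intro k
    simp only [hD]
    rw [integral_const_mul, integral_const_mul, integral_const_mul,
      Measure.integral_comp_mul_left (fun x : ℝ => (1 + x ^ 2)⁻¹), integral_univ_inv_one_add_sq,
      abs_of_pos (inv_pos.2 (hm0 k)), smul_eq_mul, sq, mul_inv (2 * (k : ℝ) + n)]
    ring
  have hbound : ∀ k, ∀ᵐ l : ℝ, ‖rayWeight n l • J k l‖ ≤ D k l := by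
    intro k
    filter_upwards [ae_ne_zero] with l hl
    rw [hJval k l hl, norm_smul, norm_mul, norm_mul, Complex.norm_exp_ofReal_mul_I, one_mul,
      Complex.norm_real, Real.norm_of_nonneg (rayWeight_nonneg n l),
      Real.norm_of_nonneg (twistConst_pos hl).le, ← mul_assoc, rayWeight_mul_twistConst hl,
      mul_assoc]
    exact mul_le_mul_of_nonneg_left (hC k l z hl) (by positivity)
  have hterm : ∀ k, Integrable fun l => rayWeight n l • J k l := fun k =>
    (hDint k).mono' (hmeas k) (hbound k)
  have hsummable : Summable fun k => ∫ l, ‖rayWeight n l • J k l‖ := by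
    refine Summable.of_nonneg_of_le (fun k => integral_nonneg fun l => norm_nonneg _) (fun k => ?_)
      ((summable_inv_sq hn).mul_left (((2 * Real.pi) ^ (n + 1))⁻¹ * C * Real.pi))
    rw [← hDval k]
    exact integral_mono_ae (hterm k).norm (hDint k) (hbound k)
  have hint : Integrable (fun a : fan n =>
        ∫ w : Cn n, strichartzTransform f a w * eFan a (heisMul (-w, 0) (z, t)))
        (fanMeasure n) := by
    rw [integrable_fanMeasure_iff]
    refine ⟨hterm, hsummable.congr fun k => ?_⟩
    congr 1
    funext l
    rw [norm_smul, Real.norm_of_nonneg (rayWeight_nonneg n l)]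
  refine ⟨hint, ?_⟩
  have h1 := hasSum_integral_of_summable_integral_norm hterm hsummable
  rw [(hasSum_integral_fanMeasure hint).unique h1, ← integral_character_mul_partialFourier f z t]
  refine integral_congr_ae ?_
  filter_upwards [ae_ne_zero] with l hl
  -- With sum and integral exchanged, the sum over `k` at fixed `λ` is the Laguerre expansion of
  -- `f^λ`; its constant combines with the weight to give `(2π)⁻¹`.
  have h2 := ((hasSum_strichartzTransform_ray hn f hl z).mul_left
    ((rayWeight n l * twistConst n l : ℝ) * Complex.exp ((l * t : ℝ) * Complex.I)))
  have h3 : HasSum (fun k => rayWeight n l • J k l) (((2 * Real.pi)⁻¹ : ℝ) *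
      (Complex.exp ((l * t : ℝ) * Complex.I) * partialFourier f l z)) := by
    refine HasSum.of_eq h2 (fun k => ?_) ?_
    · rw [hJval k l hl, Complex.real_smul]
      push_cast
      ring
    · rw [← rayWeight_mul_twistConst_sq (n := n) hl]
      push_cast
      ring
  exact h3.tsum_eq.symm

end

end Strichartz

end

theorem theorem1p2 (n : ℕ) (hn : 1 ≤ n) :
    (∀ (f : 𝓢(Heis n, ℂ)) (z : Cn n) (t : ℝ),
      (∀ᵐ a ∂(fanMeasure n), Integrable
        (fun w : Cn n => strichartzTransform f a w * eFan a (heisMul (-w, 0) (z, t))) volume) ∧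
      Integrable (fun a : fan n =>
        ∫ w : Cn n, strichartzTransform f a w * eFan a (heisMul (-w, 0) (z, t)))
        (fanMeasure n) ∧
      f (z, t) = ∫ a : fan n, (∫ w : Cn n,
        strichartzTransform f a w * eFan a (heisMul (-w, 0) (z, t))) ∂(fanMeasure n)) ∧
    (∀ f : Heis n → ℂ, Integrable f volume → MemLp f 2 volume →
      (∀ᵐ a ∂(fanMeasure n), Integrable
        (fun w : Cn n => ‖strichartzTransform f a w‖ ^ 2) volume) ∧
      Integrable (fun a : fan n => ∫ w : Cn n, ‖strichartzTransform f a w‖ ^ 2)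
        (fanMeasure n) ∧
      ∫ p : Heis n, ‖f p‖ ^ 2 =
        ∫ a : fan n, (∫ w : Cn n, ‖strichartzTransform f a w‖ ^ 2) ∂(fanMeasure n)) := by
  refine ⟨fun f z t => ⟨ae_fanMeasure fun k => ?_, inversion_strichartzTransform hn f z t⟩,
    fun f hf hf2 => ⟨ae_fanMeasure fun k => ?_, plancherel_strichartzTransform hn hf hf2⟩⟩
  · filter_upwards [ae_ne_zero] with l hl
    exact (integral_strichartzTransform_mul_eFan hn f.integrable k hl z t).1
  · filter_upwards [ae_ne_zero] with l hl
    exact integrable_normSq_strichartzTransform_ray hn hf k hl
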